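/- Let $(\Sigma,\rho)$ be a complete metric space with open balls $B(x,r)=\{y:\rho(x,y)<r\}$, $r>0$, and let $\mu$ be a Borel measure on $\Sigma$ such that $(\Sigma,\rho,\mu)$ is a space of homogeneous type, i.e. $0<\mu(B(x,r))<\infty$ for all $x\in\Sigma$, $r>0$, and there is a finite constant $C_\mu$ with $\mu(B(x,2r))\le C_\mu\,\mu(B(x,r))$ for all $x\in\Sigma$, $r>0$. Assume that $\mu$ is metrically continuous, i.e. $\lim_{y\to x}\mu(B(x,r)\,\Delta\,B(y,r))=0$ for all $x\in\Sigma$, $r>0$. Let $x_0\in\Sigma$, $0<p<\infty$, $1<p_0<\infty$, and let $w\in A_{p_0}$, i.e. $w$ is measurable, $0<w<\infty$ $\mu$-a.e., and $$\sup_{B}\Big(\frac1{\mu(B)}\int_B w\,d\mu\Big)\Big(\frac1{\mu(B)}\int_B w^{1-p_0'}\,d\mu\Big)^{p_0-1}<\infty,\qquad p_0'=\frac{p_0}{p_0-1},$$ where the supremum is over all balls $B$. Let $L^p(\Sigma,w)$ be the space of (classes of) measurable real- or complex-valued functions $f$ with $\|f\|_{L^p(\Sigma,w)}=\big(\int_\Sigma|f|^p\,w\,d\mu\big)^{1/p}<\infty$,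 with the topology given by this (quasi-)norm. Then a subset $\mathcal K\subseteq L^p(\Sigma,w)$ is relatively compact (its closure in $L^p(\Sigma,w)$ is compact) if and only if the following three conditions hold: (i) $\displaystyle\sup_{f\in\mathcal K}\|f\|_{L^p(\Sigma,w)}<\infty$; (ii) $\displaystyle\lim_{A\to\infty}\ \sup_{f\in\mathcal K}\|f\,\mathbf 1_{\Sigma\setminus B(x_0,A)}\|_{L^p(\Sigma,w)}=0$; (iii) $\displaystyle\lim_{r\to0^+}\ \sup_{f\in\mathcal K}\int_\Sigma\Big(\frac1{\mu(B(x,r))}\int_{B(x,r)}|f(x)-f(y)|^{p/p_0}\,d\mu(y)\Big)^{p_0}w(x)\,d\mu(x)=0$. -/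

import Mathlib

open MeasureTheory Set Filter Topology
open scoped ENNReal NNReal symmDiff

/-- `(X, ρ, μ)` is a space of homogeneous type: `X` is a metric space and `μ` is a Borel measure
for which balls have finite positive measure and which is doubling,
`μ (2B) ≤ C * μ B` for every ball `B`, with one finite constant `C`. -/
structure IsHomogeneousType {X : Type*} [MetricSpace X] [MeasurableSpace X]
    (μ : Measure X) : Prop where
  measure_ball_pos : ∀ (x : X) (r : ℝ), 0 < r → 0 < μ (Metric.ball x r)
  measure_ball_lt_top : ∀ (x : X) (r : ℝ), 0 < r → μ (Metric.ball x r) < ∞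
  doubling : ∃ C : ℝ≥0, ∀ (x : X) (r : ℝ), 0 < r →
    μ (Metric.ball x (2 * r)) ≤ C * μ (Metric.ball x r)

/-- `μ` is metrically continuous: `μ (B(x, r) ∆ B(y, r)) → 0` as `y → x`, for all `x` and
all `r > 0`. -/
def IsMetricallyContinuous {X : Type*} [MetricSpace X] [MeasurableSpace X]
    (μ : Measure X) : Prop :=
  ∀ (x : X) (r : ℝ), 0 < r →
    Tendsto (fun y => μ (Metric.ball x r ∆ Metric.ball y r)) (𝓝 x) (𝓝 0)

/-- A weight: a measurable function (up to `μ`-null sets) with `0 < w < ∞` almost everywhere. -/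
structure IsWeight {X : Type*} [MeasurableSpace X] (μ : Measure X) (w : X → ℝ≥0∞) : Prop where
  aemeasurable : AEMeasurable w μ
  pos : ∀ᵐ x ∂μ, 0 < w x
  lt_top : ∀ᵐ x ∂μ, w x < ∞

/-- The Muckenhoupt constant `[w]_{A_p}` with respect to the family of all metric balls,
`sup_B (⨍_B w) (⨍_B w ^ (1 - p')) ^ (p - 1)` with `p' = p / (p - 1)`, for `1 < p < ∞`. -/
noncomputable def muckenhouptConst {X : Type*} [MetricSpace X] [MeasurableSpace X]
    (p : ℝ) (μ : Measure X) (w : X → ℝ≥0∞) : ℝ≥0∞ :=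
  ⨆ (x : X) (r : ℝ) (_ : 0 < r),
    (⨍⁻ y in Metric.ball x r, w y ∂μ) *
      (⨍⁻ y in Metric.ball x r, w y ^ (1 - p.conjExponent) ∂μ) ^ (p - 1)

/-- The Muckenhoupt class `A_p` of weights with respect to the family of all metric balls,
for `1 < p < ∞`. -/
structure IsMuckenhoupt {X : Type*} [MetricSpace X] [MeasurableSpace X]
    (p : ℝ) (μ : Measure X) (w : X → ℝ≥0∞) : Prop where
  isWeight : IsWeight μ w
  const_lt_top : muckenhouptConst p μ w < ∞

/-- The weighted space `L^p(X, w) = L^p(X, w dμ)`, `0 < p < ∞`: (classes of) measurable functions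
`f` with `∫ |f|^p w dμ < ∞`. -/
noncomputable abbrev WeightedLp {X : Type*} [MeasurableSpace X] (𝕜 : Type*) [RCLike 𝕜]
    (p : ℝ) (μ : Measure X) (w : X → ℝ≥0∞) : AddSubgroup (X →ₘ[μ.withDensity w] 𝕜) :=
  Lp 𝕜 (ENNReal.ofReal p) (μ.withDensity w)

/-- The (quasi-)norm `‖f‖_{L^p(X, w)} = (∫ |f|^p w dμ)^(1/p)` of a function, `0 < p < ∞`. -/
noncomputable abbrev weightedLpNorm {X : Type*} [MeasurableSpace X] {𝕜 : Type*} [RCLike 𝕜]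
    (p : ℝ) (μ : Measure X) (w : X → ℝ≥0∞) (f : X → 𝕜) : ℝ≥0∞ :=
  eLpNorm f (ENNReal.ofReal p) (μ.withDensity w)

/-- The topology of `L^p(X, w)` given by the (quasi-)norm: a set `U` is open if around each of its
points it contains a (quasi-)norm ball. (Mathlib has this topology for `1 ≤ p` only.) -/
abbrev weightedLpTopology {X : Type*} [MeasurableSpace X] (𝕜 : Type*) [RCLike 𝕜]
    (p : ℝ) (μ : Measure X) (w : X → ℝ≥0∞) : TopologicalSpace (WeightedLp 𝕜 p μ w) where
  IsOpen U := ∀ f ∈ U, ∃ ε : ℝ≥0∞, 0 < ε ∧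
    ∀ g : WeightedLp 𝕜 p μ w, weightedLpNorm p μ w (g - f : WeightedLp 𝕜 p μ w) < ε → g ∈ U
  isOpen_univ := fun _ _ => ⟨1, one_pos, fun _ _ => mem_univ _⟩
  isOpen_inter := fun U V hU hV f hf => by
    obtain ⟨ε, hε, h⟩ := hU f hf.1
    obtain ⟨δ, hδ, h'⟩ := hV f hf.2
    exact ⟨min ε δ, lt_min hε hδ, fun g hg =>
      ⟨h g (hg.trans_le (min_le_left _ _)), h' g (hg.trans_le (min_le_right _ _))⟩⟩
  isOpen_sUnion := fun S hS f hf => by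
    obtain ⟨U, hU, hfU⟩ := hf
    obtain ⟨ε, hε, h⟩ := hS U hU f hfU
    exact ⟨ε, hε, fun g hg => ⟨U, hU, h g hg⟩⟩

/-- `K` is relatively compact in `L^p(X, w)`: its closure is compact. -/
def IsRelativelyCompactLp {X : Type*} [MeasurableSpace X] {𝕜 : Type*} [RCLike 𝕜]
    {p : ℝ} {μ : Measure X} {w : X → ℝ≥0∞} (K : Set (WeightedLp 𝕜 p μ w)) : Prop :=
  @IsCompact _ (weightedLpTopology 𝕜 p μ w) (closure[weightedLpTopology 𝕜 p μ w] K)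

/-! Put `q = p / p₀`, `ν = w dμ`, and let `O_r f(x)` be the `μ`-average of `|f(x) - f(y)|^q` over
`B(x, r)`; condition (iii) says that `∫ (O_r f)^p₀ dν` tends to zero uniformly on `K`. The power
`min 1 p` of the quasi-norm of a difference is a complete metric, so relative compactness means
finite nets at every scale (`isRelativelyCompactLp_iff_finite_net`).

Sufficiency (`IsHomogeneousType.exists_finite_net`): doubling makes balls totally bounded, so a
large ball splits into finitely many cells of small diameter. If `x, x'` lie in one cell, averaging
over an intermediate point bounds `|f(x) - f(x')|^q` by the oscillations at `x` and `x'`. Taking for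
`x'` a point of at most average oscillation shows that `f` is close in `L^p(ν)` to a step function
on the cells. By (i) the coefficients stay in a totally bounded subset of a finite-dimensional
space, and by (ii) the rest of `f` is negligible.

Necessity: a finite net reduces each condition to single functions. For (iii) this needs `∫ (O_r
f)^p₀ dν ≤ C ∫ |f|^p dν` with `C` independent of `r`. That follows from the uniform boundedness of
averaging operators on `L^p₀(w)` (`IsMuckenhoupt.lintegral_laverage_rpow_le`), where the `A_p₀`
condition enters. For a single function, approximate by a continuous one with compact support. -/

namespace ENNReal

/-- The constant is not sharp, but one inequality covers exponents on both sides of `1`. -/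
theorem add_rpow_le_two_rpow_mul (a b : ℝ≥0∞) {q : ℝ} (hq : 0 ≤ q) :
    (a + b) ^ q ≤ 2 ^ q * (a ^ q + b ^ q) := by
  have h : a + b ≤ 2 * max a b := by
    rw [two_mul]; exact add_le_add (le_max_left _ _) (le_max_right _ _)
  refine (ENNReal.rpow_le_rpow h hq).trans ?_
  rw [ENNReal.mul_rpow_of_nonneg _ _ hq]
  gcongr
  rcases le_total a b with h | h
  · rw [max_eq_right h]; exact le_add_self
  · rw [max_eq_left h]; exact le_self_add

end ENNReal

/-! ### The complete metric on `L^p` for all positive exponents -/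

section LpMetric

variable {α E : Type*} [MeasurableSpace α] {ν : Measure α} [NormedAddCommGroup E] {p : ℝ}

theorem eLpNorm_ofReal_rpow (hp : 0 < p) (f : α → E) :
    eLpNorm f (ENNReal.ofReal p) ν ^ p = ∫⁻ x, ‖f x‖ₑ ^ p ∂ν := by
  rw [eLpNorm_eq_lintegral_rpow_enorm_toReal (by simpa using hp) ENNReal.ofReal_ne_top,
    ENNReal.toReal_ofReal hp.le, ← ENNReal.rpow_mul, one_div, inv_mul_cancel₀ hp.ne',
    ENNReal.rpow_one]

/-- Minkowski's inequality for `p ≥ 1`; for `p ≤ 1`, the subadditivity of `t ↦ t ^ p`, integrated.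
-/
theorem eLpNorm_add_rpow_le (hp : 0 < p) {f g : α → E}
    (hf : AEStronglyMeasurable f ν) (hg : AEStronglyMeasurable g ν) :
    eLpNorm (f + g) (ENNReal.ofReal p) ν ^ min 1 p ≤
      eLpNorm f (ENNReal.ofReal p) ν ^ min 1 p + eLpNorm g (ENNReal.ofReal p) ν ^ min 1 p := by
  rcases le_total 1 p with h | h
  · simpa [min_eq_left h] using eLpNorm_add_le hf hg (by simpa using h)
  · rw [min_eq_right h, eLpNorm_ofReal_rpow hp, eLpNorm_ofReal_rpow hp, eLpNorm_ofReal_rpow hp,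
      ← lintegral_add_left' (hf.enorm.pow_const p)]
    refine lintegral_mono fun x => ?_
    exact (ENNReal.rpow_le_rpow (enorm_add_le _ _) hp.le).trans
      (ENNReal.rpow_add_le_add_rpow _ _ hp.le h)

/-- The translation-invariant metric `‖f - g‖ ^ min 1 p` on `L^p`, `0 < p < ∞`. -/
noncomputable abbrev Lp.pseudoEMetricSpaceOfPos (E : Type*) [NormedAddCommGroup E] {p : ℝ}
    (hp : 0 < p) (ν : Measure α) :
    PseudoEMetricSpace (Lp E (ENNReal.ofReal p) ν) where
  edist f g := eLpNorm (f - g : Lp E (ENNReal.ofReal p) ν) (ENNReal.ofReal p) ν ^ min 1 p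
  edist_self f := by
    rw [sub_self, eLpNorm_congr_ae (Lp.coeFn_zero _ _ _), eLpNorm_zero,
      ENNReal.zero_rpow_of_pos (by positivity)]
  edist_comm f g := by
    rw [← neg_sub g f, eLpNorm_congr_ae (Lp.coeFn_neg _), eLpNorm_neg]
  edist_triangle f g h := by
    rw [← sub_add_sub_cancel f g h, eLpNorm_congr_ae (Lp.coeFn_add _ _)]
    exact eLpNorm_add_rpow_le hp (Lp.aestronglyMeasurable _) (Lp.aestronglyMeasurable _)

/-- Chebyshev and Borel–Cantelli: almost everywhere, consecutive terms eventually differ by less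
than `2⁻ⁿ`, so the sequence of values is Cauchy. -/
theorem exists_ae_tendsto_of_eLpNorm_sub_lt [CompleteSpace E] (hp : 0 < p) {f : ℕ → α → E}
    (hf : ∀ n, AEStronglyMeasurable (f n) ν)
    (h : ∀ N n m : ℕ, N ≤ n → N ≤ m →
      eLpNorm (f n - f m) (ENNReal.ofReal p) ν < (4⁻¹ : ℝ≥0∞) ^ N) :
    ∀ᵐ x ∂ν, ∃ l : E, Tendsto (fun n => f n x) atTop (𝓝 l) := by
  -- Chebyshev at level `2⁻ⁿ` against a norm below `4⁻ⁿ` leaves `(2ⁿ 4⁻ⁿ) ^ p`, a summable geometric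
  -- sequence.
  have hmeas (n : ℕ) : ν {x | (2⁻¹ : ℝ≥0∞) ^ n ≤ ‖(f n - f (n + 1)) x‖ₑ} ≤
      ((2⁻¹ : ℝ≥0∞) ^ p) ^ n := by
    refine (meas_ge_le_mul_pow_eLpNorm_enorm ν (by simpa using hp) ENNReal.ofReal_ne_top
      ((hf n).sub (hf (n + 1))) (ε := (2⁻¹ : ℝ≥0∞) ^ n) (by simp) (by
        intro h; exact absurd h (by simp))).trans ?_
    have hpow : ((2⁻¹ : ℝ≥0∞) ^ p) ^ n = ((2⁻¹ : ℝ≥0∞) ^ n) ^ p := by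
      rw [← ENNReal.rpow_natCast, ← ENNReal.rpow_natCast, ← ENNReal.rpow_mul, ← ENNReal.rpow_mul,
        mul_comm]
    rw [ENNReal.toReal_ofReal hp.le, ← ENNReal.mul_rpow_of_nonneg _ _ hp.le, hpow]
    refine ENNReal.rpow_le_rpow ?_ hp.le
    refine (mul_le_mul_right (h n n (n + 1) le_rfl (by omega)).le _).trans ?_
    rw [← ENNReal.inv_pow, inv_inv, ← mul_pow]
    have h42 : (2 : ℝ≥0∞) * 4⁻¹ = 2⁻¹ := by
      rw [show (4 : ℝ≥0∞) = 2 * 2 by norm_num, ENNReal.mul_inv (by simp) (by simp), ← mul_assoc,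
        ENNReal.mul_inv_cancel (by simp) (by simp), one_mul]
    rw [h42, ENNReal.inv_pow]
  have hsum : ∑' n, ν {x | (2⁻¹ : ℝ≥0∞) ^ n ≤ ‖(f n - f (n + 1)) x‖ₑ} ≠ ∞ := by
    refine ne_top_of_le_ne_top ?_ (ENNReal.tsum_le_tsum hmeas)
    rw [ENNReal.tsum_geometric]
    refine ENNReal.inv_ne_top.2 (tsub_pos_of_lt ?_).ne'
    exact ENNReal.rpow_lt_one (by simp) hp
  filter_upwards [ae_eventually_notMem hsum] with x hx
  obtain ⟨N, hN⟩ := eventually_atTop.1 hx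
  refine cauchySeq_tendsto_of_complete ((cauchySeq_shift N).1 ?_)
  refine cauchySeq_of_edist_le_geometric 2⁻¹ 1 (by simp) (by simp) fun n => ?_
  have := hN (n + N) (by omega)
  simp only [not_le, Pi.sub_apply] at this
  rw [edist_eq_enorm_sub, one_mul, add_right_comm]
  exact this.le.trans (pow_le_pow_right_of_le_one' (by simp) (by omega))

theorem Lp.completeSpace_of_pos [CompleteSpace E] (hp : 0 < p) :
    @CompleteSpace (Lp E (ENNReal.ofReal p) ν)
      (Lp.pseudoEMetricSpaceOfPos E hp ν).toUniformSpace := by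
  let := Lp.pseudoEMetricSpaceOfPos E hp ν
  have hs : 0 < min 1 p := by positivity
  refine EMetric.complete_of_convergent_controlled_sequences
    (fun N => ((4⁻¹ : ℝ≥0∞) ^ N) ^ min 1 p) (fun N => ENNReal.rpow_pos (ENNReal.pow_pos (by simp) N) (by simp))
    fun u hu => ?_
  have hu' (N n m : ℕ) (hn : N ≤ n) (hm : N ≤ m) :
      eLpNorm (⇑(u n) - ⇑(u m)) (ENNReal.ofReal p) ν < (4⁻¹ : ℝ≥0∞) ^ N := by
    rw [← eLpNorm_congr_ae (Lp.coeFn_sub _ _)]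
    exact (ENNReal.rpow_lt_rpow_iff hs).1 (hu N n m hn hm)
  have hae := exists_ae_tendsto_of_eLpNorm_sub_lt hp (fun n => Lp.aestronglyMeasurable (u n)) hu'
  obtain ⟨g, hg, hlim⟩ := exists_stronglyMeasurable_limit_of_tendsto_ae
    (fun n => Lp.aestronglyMeasurable (u n)) hae
  have hB : ∑' n : ℕ, (4⁻¹ : ℝ≥0∞) ^ n ≠ ∞ := by
    rw [ENNReal.tsum_geometric]
    refine ENNReal.inv_ne_top.2 (tsub_pos_of_lt ?_).ne'
    exact ENNReal.inv_lt_one.2 (by norm_num)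
  have htend := Lp.cauchy_tendsto_of_tendsto (fun n => Lp.aestronglyMeasurable (u n)) g hB hu' hlim
  have hgLp : MemLp g (ENNReal.ofReal p) ν := by
    obtain ⟨n, hn⟩ := (htend.eventually (gt_mem_nhds ENNReal.zero_lt_top)).exists
    have : MemLp (⇑(u n) - g) (ENNReal.ofReal p) ν :=
      ⟨(Lp.aestronglyMeasurable _).sub hg.aestronglyMeasurable, hn⟩
    simpa using (Lp.memLp (u n)).sub this
  refine ⟨hgLp.toLp g, tendsto_iff_edist_tendsto_0.2 ?_⟩
  have hcomp := (ENNReal.continuous_rpow_const (y := min 1 p)).tendsto 0 |>.comp htend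
  rw [ENNReal.zero_rpow_of_pos hs] at hcomp
  refine hcomp.congr fun n => ?_
  change _ = eLpNorm (u n - hgLp.toLp g : Lp E (ENNReal.ofReal p) ν) _ _ ^ _
  rw [eLpNorm_congr_ae ((Lp.coeFn_sub _ _).trans (EventuallyEq.rfl.sub hgLp.coeFn_toLp))]
  rfl

end LpMetric

/-! ### Relative compactness as total boundedness -/

section WeightedTopology

variable {X : Type*} [MeasurableSpace X] {𝕜 : Type*} [RCLike 𝕜] {p : ℝ} {μ : Measure X}
  {w : X → ℝ≥0∞}

/-- Raising the quasi-norm to the power `min 1 p` only relabels the radii of the balls. -/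
theorem weightedLpTopology_eq (hp : 0 < p) :
    weightedLpTopology 𝕜 p μ w =
      (Lp.pseudoEMetricSpaceOfPos 𝕜 hp (μ.withDensity w)).toUniformSpace.toTopologicalSpace := by
  let := Lp.pseudoEMetricSpaceOfPos 𝕜 hp (μ.withDensity w)
  have hs : 0 < min 1 p := by positivity
  refine TopologicalSpace.ext_iff.2 fun U => ?_
  rw [EMetric.isOpen_iff]
  constructor
  · intro h f hf
    obtain ⟨ε, hε, h⟩ := h f hf
    refine ⟨ε ^ min 1 p, ?_, fun g hg => h g ?_⟩
    · exact ENNReal.rpow_pos_of_nonneg hε hs.le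
    · exact (ENNReal.rpow_lt_rpow_iff hs).1 hg
  · intro h f hf
    obtain ⟨ε, hε, h⟩ := h f hf
    refine ⟨ε ^ (min 1 p)⁻¹, ENNReal.rpow_pos_of_nonneg hε (inv_pos.2 hs).le, fun g hg => h ?_⟩
    exact (ENNReal.lt_rpow_inv_iff hs).1 hg

/-- Relative compactness in `L^p(X, w)` is total boundedness for the (quasi-)norm. -/
theorem isRelativelyCompactLp_iff_finite_net (hp : 0 < p) {K : Set (WeightedLp 𝕜 p μ w)} :
    IsRelativelyCompactLp K ↔ ∀ ε : ℝ≥0∞, 0 < ε → ∃ t : Set (WeightedLp 𝕜 p μ w), t.Finite ∧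
      ∀ f ∈ K, ∃ g ∈ t, weightedLpNorm p μ w (f - g : WeightedLp 𝕜 p μ w) < ε := by
  have hs : 0 < min 1 p := by positivity
  unfold IsRelativelyCompactLp
  rw [weightedLpTopology_eq hp]
  let := Lp.pseudoEMetricSpaceOfPos 𝕜 hp (μ.withDensity w)
  have := Lp.completeSpace_of_pos (E := 𝕜) (ν := μ.withDensity w) hp
  have h1 : IsCompact (closure K) ↔ TotallyBounded K :=
    ⟨fun h => h.totallyBounded.subset subset_closure,
      fun h => h.closure.isCompact_of_isClosed isClosed_closure⟩
  refine h1.trans (EMetric.totallyBounded_iff.trans ⟨fun h ε hε => ?_, fun h ε hε => ?_⟩)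
  · obtain ⟨t, ht, hK⟩ := h (ε ^ min 1 p) (ENNReal.rpow_pos_of_nonneg hε hs.le)
    refine ⟨t, ht, fun f hf => ?_⟩
    obtain ⟨g, hg, hfg⟩ := mem_iUnion₂.1 (hK hf)
    exact ⟨g, hg, (ENNReal.rpow_lt_rpow_iff hs).1 hfg⟩
  · obtain ⟨t, ht, hK⟩ := h (ε ^ (min 1 p)⁻¹) (ENNReal.rpow_pos_of_nonneg hε (inv_pos.2 hs).le)
    refine ⟨t, ht, fun f hf => ?_⟩
    obtain ⟨g, hg, hfg⟩ := hK f hf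
    exact mem_iUnion₂.2 ⟨g, hg, (ENNReal.lt_rpow_inv_iff hs).1 hfg⟩

end WeightedTopology

/-! ### Compactness from doubling -/

namespace IsHomogeneousType

variable {X : Type*} [MetricSpace X] [MeasurableSpace X] {μ : Measure X}

theorem measure_ball_two_pow_mul_le (hμ : IsHomogeneousType μ) :
    ∃ C : ℝ≥0, 0 < C ∧ ∀ (x : X) (r : ℝ), 0 < r → ∀ n : ℕ,
      μ (Metric.ball x (2 ^ n * r)) ≤ C ^ n * μ (Metric.ball x r) := by
  obtain ⟨C, hC⟩ := hμ.doubling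
  refine ⟨max C 1, by positivity, fun x r hr n => ?_⟩
  induction n with
  | zero => simp
  | succ n ih =>
    calc μ (Metric.ball x (2 ^ (n + 1) * r)) = μ (Metric.ball x (2 * (2 ^ n * r))) := by
          rw [pow_succ']; ring_nf
      _ ≤ C * μ (Metric.ball x (2 ^ n * r)) := hC _ _ (by positivity)
      _ ≤ (max C 1 : ℝ≥0) * ((max C 1 : ℝ≥0) ^ n * μ (Metric.ball x r)) := by
          gcongr; exact le_max_left _ _
      _ = _ := by rw [pow_succ', mul_assoc]

/-- Packing by volume: an infinite `ε`-separated sequence in the ball would give infinitely many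
disjoint balls inside a set of finite measure, while doubling bounds their measures below. -/
theorem totallyBounded_ball [BorelSpace X] (hμ : IsHomogeneousType μ) (x₀ : X) (R : ℝ) :
    TotallyBounded (Metric.ball x₀ R) := by
  rcases le_or_gt R 0 with hR | hR
  · simp [Metric.ball_eq_empty.2 hR]
  obtain ⟨C, hC, hdoub⟩ := hμ.measure_ball_two_pow_mul_le
  refine Metric.totallyBounded_iff.2 fun ε hε => ?_
  by_contra! hcon
  have hsymm : Std.Symm fun x y : X => ε ≤ dist x y := ⟨fun x y h => by rwa [dist_comm]⟩
  obtain ⟨u, huR, hsep⟩ := exists_seq_of_forall_finset_exists' (fun x => x ∈ Metric.ball x₀ R)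
    (fun x y => ε ≤ dist x y) (fun s _ => by
      obtain ⟨y, hy, hys⟩ := not_subset.1 (hcon s s.finite_toSet)
      refine ⟨y, hy, fun x hx => ?_⟩
      simp only [Finset.mem_coe, mem_iUnion, Metric.mem_ball, not_exists, not_lt] at hys
      rw [dist_comm]; exact hys x hx)
  have hdisj : Pairwise (Function.onFun Disjoint fun n => Metric.ball (u n) (ε / 2)) :=
    fun m n hmn => Metric.ball_disjoint_ball (by linarith [hsep hmn])
  have hsub : ⋃ n, Metric.ball (u n) (ε / 2) ⊆ Metric.ball x₀ (R + ε / 2) :=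
    iUnion_subset fun n => Metric.ball_subset_ball' (by
      have := Metric.mem_ball.1 (huR n); linarith)
  -- After `k` doublings the ball of radius `ε / 2` about any `u n` contains `B(x₀, R)`.
  obtain ⟨k, hk⟩ := pow_unbounded_of_one_lt (2 * R / (ε / 2)) (one_lt_two : (1 : ℝ) < 2)
  have hlow (n : ℕ) : (C : ℝ≥0∞)⁻¹ ^ k * μ (Metric.ball x₀ R) ≤ μ (Metric.ball (u n) (ε / 2)) := by
    rw [← ENNReal.inv_pow, mul_comm, ← div_eq_mul_inv]
    refine ENNReal.div_le_of_le_mul' ((measure_mono (Metric.ball_subset_ball' ?_)).trans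
      (hdoub _ _ (half_pos hε) k))
    have := Metric.mem_ball'.1 (huR n)
    rw [div_lt_iff₀ (by positivity)] at hk
    linarith
  have hfin := Measure.finite_const_le_meas_of_disjoint_iUnion μ
    (ε := (C : ℝ≥0∞)⁻¹ ^ k * μ (Metric.ball x₀ R))
    (ENNReal.mul_pos (pow_ne_zero k (by simp)) (hμ.measure_ball_pos x₀ R hR).ne')
    (fun n => Metric.isOpen_ball.measurableSet) hdisj
    (ne_top_of_le_ne_top (hμ.measure_ball_lt_top x₀ _ (by positivity)).ne (measure_mono hsub))
  exact infinite_univ (α := ℕ) (hfin.subset fun n _ => hlow n)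

theorem properSpace [CompleteSpace X] [BorelSpace X] (hμ : IsHomogeneousType μ) :
    ProperSpace X where
  isCompact_closedBall x r :=
    ((hμ.totallyBounded_ball x (r + 1)).subset
      (Metric.closedBall_subset_ball (by linarith))).isCompact_of_isClosed Metric.isClosed_closedBall

theorem isLocallyFiniteMeasure (hμ : IsHomogeneousType μ) : IsLocallyFiniteMeasure μ where
  finiteAtNhds x := ⟨Metric.ball x 1, Metric.ball_mem_nhds x one_pos,
    hμ.measure_ball_lt_top x 1 one_pos⟩

end IsHomogeneousType

/-- A totally bounded set is covered by finitely many disjoint measurable sets of small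
diameter. -/
theorem TotallyBounded.exists_finite_measurable_partition {X : Type*} [MetricSpace X]
    [MeasurableSpace X] [OpensMeasurableSpace X] {s : Set X} (hs : TotallyBounded s) {r : ℝ}
    (hr : 0 < r) :
    ∃ (N : ℕ) (z : Fin N → X) (E : Fin N → Set X), (∀ i, MeasurableSet (E i)) ∧
      Pairwise (Function.onFun Disjoint E) ∧ (∀ i, E i ⊆ Metric.ball (z i) r) ∧ s ⊆ ⋃ i, E i := by
  obtain ⟨t, ht, hst⟩ := Metric.totallyBounded_iff.1 hs r hr
  obtain ⟨N, z, -, rfl⟩ := ht.fin_param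
  refine ⟨N, z, disjointed fun i => Metric.ball (z i) r, fun i => ?_, disjoint_disjointed _,
    fun i => disjointed_le _ i, ?_⟩
  · exact disjointedRec (fun _ _ h => h.diff Metric.isOpen_ball.measurableSet)
      Metric.isOpen_ball.measurableSet
  · simpa [iUnion_disjointed] using hst

/-! ### Mean oscillation and approximation by constants -/

section Oscillation

variable {X : Type*} [MetricSpace X] [MeasurableSpace X] {E : Type*} [NormedAddCommGroup E]

/-- The mean oscillation `⨍_{B(x, r)} |f(x) - f(y)|^q dμ(y)` of `f` at `x` and scale `r`. -/
noncomputable def meanOscillation (μ : Measure X) (q r : ℝ) (f : X → E) (x : X) : ℝ≥0∞ :=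
  ⨍⁻ y in Metric.ball x r, ‖f x - f y‖ₑ ^ q ∂μ

/-- The relation `dist y x < r` is open in the product, so Tonelli's theorem applies to its
indicator. -/
theorem measurable_setLIntegral_ball [OpensMeasurableSpace X] [SecondCountableTopology X]
    {μ : Measure X} [SFinite μ] (r : ℝ) {g : X → X → ℝ≥0∞} (hg : Measurable (Function.uncurry g)) :
    Measurable fun x => ∫⁻ y in Metric.ball x r, g x y ∂μ := by
  have hS : MeasurableSet {z : X × X | dist z.2 z.1 < r} :=
    (isOpen_lt (by fun_prop) continuous_const).measurableSet
  have hind (x : X) : ∫⁻ y in Metric.ball x r, g x y ∂μ =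
      ∫⁻ y, {z : X × X | dist z.2 z.1 < r}.indicator (Function.uncurry g) (x, y) ∂μ := by
    rw [← lintegral_indicator Metric.isOpen_ball.measurableSet]
    rfl
  simp_rw [hind]
  exact (hg.indicator hS).lintegral_prod_right'

theorem measurable_measure_ball [OpensMeasurableSpace X] [SecondCountableTopology X]
    {μ : Measure X} [SFinite μ] (r : ℝ) : Measurable fun x => μ (Metric.ball x r) := by
  simpa using measurable_setLIntegral_ball (μ := μ) r (g := fun _ _ => 1) measurable_const

theorem measurable_meanOscillation [OpensMeasurableSpace X] [SecondCountableTopology X]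
    {μ : Measure X} [SFinite μ] [MeasurableSpace E] [BorelSpace E] [SecondCountableTopology E]
    (q r : ℝ) {f : X → E} (hf : Measurable f) : Measurable (meanOscillation μ q r f) := by
  unfold meanOscillation
  simp_rw [setLAverage_eq]
  refine (measurable_setLIntegral_ball r ?_).div (measurable_measure_ball r)
  exact (((hf.comp measurable_fst).sub (hf.comp measurable_snd)).enorm.pow_const q)

variable {μ : Measure X}

/-- `B(z, r) ⊆ B(x, 2r) ⊆ B(z, 4r)`, so the two balls have comparable measure; two doublings give `C
^ 2`. -/
theorem IsHomogeneousType.setLAverage_ball_le (hμ : IsHomogeneousType μ) :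
    ∃ D : ℝ≥0, ∀ (z x : X) (r : ℝ), 0 < r → x ∈ Metric.ball z r → ∀ g : X → ℝ≥0∞,
      ⨍⁻ y in Metric.ball z r, g y ∂μ ≤ D * ⨍⁻ y in Metric.ball x (2 * r), g y ∂μ := by
  obtain ⟨C, hC, hdoub⟩ := hμ.measure_ball_two_pow_mul_le
  refine ⟨C ^ 2, fun z x r hr hx g => ?_⟩
  have hxz := Metric.mem_ball.1 hx
  have h1 : μ (Metric.ball x (2 * r)) ≤ C ^ 2 * μ (Metric.ball z r) :=
    (measure_mono (Metric.ball_subset_ball' (by linarith))).trans (hdoub z r hr 2)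
  have h2 : Metric.ball z r ⊆ Metric.ball x (2 * r) :=
    Metric.ball_subset_ball' (by rw [dist_comm]; linarith)
  have h0 := hμ.measure_ball_pos z r hr
  have ht := hμ.measure_ball_lt_top z r hr
  have h0' := hμ.measure_ball_pos x (2 * r) (by positivity)
  have ht' := hμ.measure_ball_lt_top x (2 * r) (by positivity)
  rw [setLAverage_eq, setLAverage_eq]
  refine ENNReal.div_le_of_le_mul' ?_
  calc ∫⁻ y in Metric.ball z r, g y ∂μ ≤ ∫⁻ y in Metric.ball x (2 * r), g y ∂μ :=
        lintegral_mono_set h2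
    _ = μ (Metric.ball x (2 * r)) *
        ((∫⁻ y in Metric.ball x (2 * r), g y ∂μ) / μ (Metric.ball x (2 * r))) :=
        (ENNReal.mul_div_cancel h0'.ne' ht'.ne).symm
    _ ≤ (C ^ 2 * μ (Metric.ball z r)) *
        ((∫⁻ y in Metric.ball x (2 * r), g y ∂μ) / μ (Metric.ball x (2 * r))) := by gcongr
    _ = _ := by push_cast; ring

/-- Two values of a function at points of a ball differ by at most the mean oscillations there. -/
theorem IsHomogeneousType.enorm_sub_rpow_le_meanOscillation [OpensMeasurableSpace X]
    [MeasurableSpace E] [BorelSpace E] [SecondCountableTopology E]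
    (hμ : IsHomogeneousType μ) {q : ℝ} (hq : 0 < q) :
    ∃ C : ℝ≥0, ∀ (z x x' : X) (r : ℝ), 0 < r → x ∈ Metric.ball z r → x' ∈ Metric.ball z r →
      ∀ f : X → E, Measurable f → ‖f x - f x'‖ₑ ^ q ≤
        C * (meanOscillation μ q (2 * r) f x + meanOscillation μ q (2 * r) f x') := by
  obtain ⟨D, hD⟩ := hμ.setLAverage_ball_le
  refine ⟨2 ^ q * D, fun z x x' r hr hx hx' f hf => ?_⟩
  -- Insert a third point `y` and average over `y ∈ B(z, r)`; the left side does not depend on `y`.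
  have hpt (y : X) : ‖f x - f x'‖ₑ ^ q ≤ 2 ^ q * (‖f x - f y‖ₑ ^ q + ‖f x' - f y‖ₑ ^ q) := by
    refine le_trans ?_ (ENNReal.add_rpow_le_two_rpow_mul _ _ hq.le)
    gcongr
    rw [← enorm_neg (f x' - f y), neg_sub, ← sub_add_sub_cancel (f x) (f y) (f x')]
    exact enorm_add_le _ _
  have hm (u : X) : Measurable fun y => ‖f u - f y‖ₑ ^ q :=
    (measurable_const.sub hf).enorm.pow_const q
  calc ‖f x - f x'‖ₑ ^ q = ⨍⁻ _ in Metric.ball z r, ‖f x - f x'‖ₑ ^ q ∂μ :=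
        (setLAverage_const (hμ.measure_ball_pos z r hr).ne'
          (hμ.measure_ball_lt_top z r hr).ne _).symm
    _ ≤ ⨍⁻ y in Metric.ball z r, 2 ^ q * (‖f x - f y‖ₑ ^ q + ‖f x' - f y‖ₑ ^ q) ∂μ :=
        lintegral_mono hpt
    _ = 2 ^ q * (⨍⁻ y in Metric.ball z r, ‖f x - f y‖ₑ ^ q ∂μ +
          ⨍⁻ y in Metric.ball z r, ‖f x' - f y‖ₑ ^ q ∂μ) := by
        simp only [laverage]
        rw [lintegral_const_mul' _ _ (by finiteness), lintegral_add_left (hm x)]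
    _ ≤ 2 ^ q * (D * meanOscillation μ q (2 * r) f x + D * meanOscillation μ q (2 * r) f x') := by
        gcongr
        · exact hD z x r hr hx _
        · exact hD z x' r hr hx' _
    _ = _ := by
        rw [← mul_add, ← mul_assoc]; push_cast
        rw [ENNReal.coe_rpow_of_nonneg _ hq.le]; rfl

/-- On a small set a function is within its mean oscillation of a constant. -/
theorem IsHomogeneousType.exists_const_setLIntegral_sub_le [BorelSpace X]
    [SecondCountableTopology X] [SFinite μ] [MeasurableSpace E] [BorelSpace E]
    [SecondCountableTopology E] (hμ : IsHomogeneousType μ) {q s : ℝ} (hq : 0 < q) (hs : 0 < s) :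
    ∃ C : ℝ≥0, ∀ (ν : Measure X) (z : X) (r : ℝ) (A : Set X), 0 < r → A ⊆ Metric.ball z r →
      MeasurableSet A → ν A ≠ ∞ → ∀ f : X → E, Measurable f → ∃ c : E, (ν A = 0 → c = 0) ∧
        ∫⁻ x in A, ‖f x - c‖ₑ ^ (q * s) ∂ν ≤
          C * ∫⁻ x in A, meanOscillation μ q (2 * r) f x ^ s ∂ν := by
  obtain ⟨C, hC⟩ := hμ.enorm_sub_rpow_le_meanOscillation (E := E) hq
  refine ⟨C ^ s * 2 ^ s * 2, fun ν z r A hr hA hAm hνA f hf => ?_⟩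
  rcases eq_or_ne (ν A) 0 with h0 | h0
  -- On a null set the integral puts no bound on the constant; fixing it to be `0` keeps the
  -- coefficients in a totally bounded set later.
  · exact ⟨0, fun _ => rfl, by simp [Measure.restrict_eq_zero.2 h0]⟩
  have hO : Measurable fun x => meanOscillation μ q (2 * r) f x ^ s :=
    (measurable_meanOscillation q (2 * r) hf).pow_const s
  -- The constant is the value of `f` at a point whose oscillation, to the power `s`, is at most its
  -- `ν`-average over `A`.
  obtain ⟨x', hx', hle⟩ := exists_le_setLAverage h0 hνA hO.aemeasurable.restrict
  refine ⟨f x', fun h => absurd h h0, ?_⟩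
  have hle' : meanOscillation μ q (2 * r) f x' ^ s * ν A ≤
      ∫⁻ x in A, meanOscillation μ q (2 * r) f x ^ s ∂ν := by
    rw [setLAverage_eq] at hle
    exact (ENNReal.le_div_iff_mul_le (Or.inl h0) (Or.inl hνA)).1 hle
  have hpt : ∀ x ∈ A, ‖f x - f x'‖ₑ ^ (q * s) ≤ (C : ℝ≥0∞) ^ s * 2 ^ s *
      (meanOscillation μ q (2 * r) f x ^ s + meanOscillation μ q (2 * r) f x' ^ s) := by
    intro x hx
    rw [ENNReal.rpow_mul]
    refine (ENNReal.rpow_le_rpow (hC z x x' r hr (hA hx) (hA hx') f hf) hs.le).trans ?_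
    rw [ENNReal.mul_rpow_of_nonneg _ _ hs.le, mul_assoc]
    gcongr
    exact ENNReal.add_rpow_le_two_rpow_mul _ _ hs.le
  calc ∫⁻ x in A, ‖f x - f x'‖ₑ ^ (q * s) ∂ν
      ≤ ∫⁻ x in A, (C : ℝ≥0∞) ^ s * 2 ^ s *
        (meanOscillation μ q (2 * r) f x ^ s + meanOscillation μ q (2 * r) f x' ^ s) ∂ν :=
        setLIntegral_mono' hAm hpt
    _ = (C : ℝ≥0∞) ^ s * 2 ^ s * (∫⁻ x in A, meanOscillation μ q (2 * r) f x ^ s ∂ν +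
          meanOscillation μ q (2 * r) f x' ^ s * ν A) := by
        rw [lintegral_const_mul' _ _ (by finiteness), lintegral_add_left hO,
          setLIntegral_const]
    _ ≤ (C : ℝ≥0∞) ^ s * 2 ^ s * (∫⁻ x in A, meanOscillation μ q (2 * r) f x ^ s ∂ν +
          ∫⁻ x in A, meanOscillation μ q (2 * r) f x ^ s ∂ν) := by gcongr
    _ = _ := by
        rw [← two_mul, ← mul_assoc]; push_cast
        rw [ENNReal.coe_rpow_of_nonneg _ hs.le, ENNReal.coe_rpow_of_nonneg _ hs.le]; rfl

end Oscillation

/-! ### Step functions on disjoint cells -/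

section StepFunctions

variable {X : Type*} [MeasurableSpace X] {E : Type*} [NormedAddCommGroup E]
  {N : ℕ} {A : Fin N → Set X}

/-- The function with the value `c i` on `A i`, for disjoint sets `A i`, and `0` elsewhere. -/
noncomputable def stepFunction (A : Fin N → Set X) (c : Fin N → E) (x : X) : E :=
  ∑ i, (A i).indicator (fun _ => c i) x

omit [MeasurableSpace X] in
theorem stepFunction_of_mem (hA : Pairwise (Function.onFun Disjoint A)) (c : Fin N → E)
    {i : Fin N} {x : X} (hx : x ∈ A i) : stepFunction A c x = c i := by
  unfold stepFunction
  rw [Finset.sum_eq_single i, indicator_of_mem hx]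
  · intro j _ hj
    exact indicator_of_notMem (fun h => disjoint_left.1 (hA hj) h hx) _
  · simp

omit [MeasurableSpace X] in
theorem stepFunction_of_notMem (c : Fin N → E) {x : X} (hx : x ∉ ⋃ i, A i) :
    stepFunction A c x = 0 := by
  refine Finset.sum_eq_zero fun i _ => indicator_of_notMem (fun h => hx (mem_iUnion_of_mem i h)) _

theorem memLp_stepFunction {ν : Measure X} (hA : ∀ i, MeasurableSet (A i)) (hν : ∀ i, ν (A i) ≠ ∞)
    (c : Fin N → E) (P : ℝ≥0∞) : MemLp (stepFunction A c) P ν :=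
  memLp_finsetSum _ fun i _ => memLp_indicator_const P (hA i) (c i) (Or.inr (hν i))

theorem lintegral_sub_stepFunction {ν : Measure X} (hA : ∀ i, MeasurableSet (A i))
    (hd : Pairwise (Function.onFun Disjoint A)) {p : ℝ} (f : X → E) (c : Fin N → E) :
    ∫⁻ x, ‖f x - stepFunction A c x‖ₑ ^ p ∂ν =
      (∑ i, ∫⁻ x in A i, ‖f x - c i‖ₑ ^ p ∂ν) + ∫⁻ x in (⋃ i, A i)ᶜ, ‖f x‖ₑ ^ p ∂ν := by
  rw [← lintegral_add_compl _ (MeasurableSet.iUnion hA), lintegral_iUnion hA hd, tsum_fintype]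
  congr 1
  · refine Finset.sum_congr rfl fun i _ => setLIntegral_congr_fun (hA i) fun x hx => ?_
    simp only [stepFunction_of_mem hd c hx]
  · refine setLIntegral_congr_fun (MeasurableSet.iUnion hA).compl fun x hx => ?_
    simp only [stepFunction_of_notMem c hx, sub_zero]

end StepFunctions

/-! ### Finite nets from bounds, tails and oscillations -/

section FiniteNet

variable {X : Type*} [MetricSpace X] [MeasurableSpace X] {E : Type*} [NormedAddCommGroup E]

/-- The set lies in a finite product of compact sets: a coordinate with `v i ≠ 0` is bounded because
`M` is finite, and one with `v i = 0` is fixed at `0`. -/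
theorem totallyBounded_setOf_enorm_rpow_mul_le [ProperSpace E] {ι : Type*} [Finite ι] {p : ℝ}
    (hp : 0 < p) {M : ℝ≥0∞} (hM : M ≠ ∞) (v : ι → ℝ≥0∞) :
    TotallyBounded {c : ι → E | ∀ i, ‖c i‖ₑ ^ p * v i ≤ M ∧ (v i = 0 → c i = 0)} := by
  have hi (i : ι) : IsCompact (closure {e : E | ‖e‖ₑ ^ p * v i ≤ M ∧ (v i = 0 → e = 0)}) := by
    refine Bornology.IsBounded.isCompact_closure ?_
    rcases eq_or_ne (v i) 0 with h0 | h0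
    · exact (Bornology.isBounded_singleton (x := (0 : E))).subset fun e he => he.2 h0
    · refine (Metric.isBounded_closedBall (x := (0 : E))
        (r := ((M / v i) ^ p⁻¹).toReal)).subset fun e he => ?_
      have hfin : (M / v i) ^ p⁻¹ ≠ ∞ :=
        ENNReal.rpow_ne_top_of_nonneg (by positivity) (ENNReal.div_ne_top hM h0)
      rw [mem_closedBall_zero_iff, ← ENNReal.ofReal_le_iff_le_toReal hfin, ofReal_norm,
        ENNReal.le_rpow_inv_iff hp]
      rcases eq_or_ne (v i) ∞ with ht | ht
      · have : ‖e‖ₑ ^ p = 0 := by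
          by_contra h
          exact hM (top_le_iff.1 (by simpa [ht, ENNReal.mul_top h] using he.1))
        simp [this]
      · exact (ENNReal.le_div_iff_mul_le (Or.inl h0) (Or.inl ht)).2 he.1
  refine (isCompact_univ_pi hi).totallyBounded.subset ?_
  intro c hc i _
  exact subset_closure (hc i)

/-- A family of functions which is bounded in `L^p(ν)`, has uniformly small tails and uniformly
small mean oscillations at small scales is totally bounded in `L^p(ν)`, `p = q * s`. -/
theorem IsHomogeneousType.exists_finite_net [BorelSpace X] [SecondCountableTopology X]
    {μ : Measure X} [SFinite μ] [MeasurableSpace E] [BorelSpace E] [ProperSpace E]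
    (hμ : IsHomogeneousType μ) {q s : ℝ} (hq : 0 < q) (hs : 0 < s) {ν : Measure X}
    (hν : ∀ (x : X) (r : ℝ), ν (Metric.ball x r) ≠ ∞) {F : Set (X → E)}
    (hF : ∀ f ∈ F, Measurable f) (x₀ : X) {M : ℝ≥0∞} (hM : M ≠ ∞)
    (hbdd : ∀ f ∈ F, ∫⁻ x, ‖f x‖ₑ ^ (q * s) ∂ν ≤ M)
    (htail : ∀ δ : ℝ≥0∞, 0 < δ → ∃ R : ℝ, ∀ f ∈ F,
      ∫⁻ x in (Metric.ball x₀ R)ᶜ, ‖f x‖ₑ ^ (q * s) ∂ν ≤ δ)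
    (hosc : ∀ δ : ℝ≥0∞, 0 < δ → ∃ r : ℝ, 0 < r ∧ ∀ f ∈ F,
      ∫⁻ x, meanOscillation μ q r f x ^ s ∂ν ≤ δ) {ε : ℝ≥0∞} (hε : 0 < ε) :
    ∃ t : Set (X → E), t.Finite ∧ (∀ g ∈ t, MemLp g (ENNReal.ofReal (q * s)) ν) ∧
      ∀ f ∈ F, ∃ g ∈ t, ∫⁻ x, ‖f x - g x‖ₑ ^ (q * s) ∂ν < ε := by
  obtain ⟨C, hC⟩ := hμ.exists_const_setLIntegral_sub_le (E := E) hq hs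
  set p := q * s with hp_def
  have hp : 0 < p := mul_pos hq hs
  -- The factor is what the final estimate produces: `C * δ` from the oscillation, `δ` from rounding
  -- the coefficients, `δ` from the tail.
  obtain ⟨δ, hδ, hδε⟩ := ENNReal.exists_nnreal_pos_mul_lt
    (a := 2 ^ p * ((C : ℝ≥0∞) + 1) + 1) (by finiteness) hε.ne'
  have hδ' : (0 : ℝ≥0∞) < δ := by exact_mod_cast hδ
  obtain ⟨R, hR⟩ := htail δ hδ'
  obtain ⟨r, hr, hr'⟩ := hosc δ hδ'
  obtain ⟨N, z, A, hAm, hAd, hAz, hAR⟩ :=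
    -- Cells of radius `r / 2`, since the approximation by constants doubles the radius.
    (hμ.totallyBounded_ball x₀ R).exists_finite_measurable_partition (half_pos hr)
  have hνA (i) : ν (A i) ≠ ∞ := ne_top_of_le_ne_top (hν (z i) (r / 2)) (measure_mono (hAz i))
  -- Rounding every coefficient to within `κ ^ p⁻¹` costs at most `κ * ∑ i, ν (A i) < δ`.
  obtain ⟨κ, hκ, hκδ⟩ := ENNReal.exists_nnreal_pos_mul_lt (a := ∑ i, ν (A i))
    (ENNReal.sum_ne_top.2 fun i _ => hνA i) hδ'.ne'
  obtain ⟨t, ht, hcov⟩ := EMetric.totallyBounded_iff.1 (totallyBounded_setOf_enorm_rpow_mul_le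
    (E := E) hp (M := 2 ^ p * (C * δ + M)) (by finiteness) fun i => ν (A i)) ((κ : ℝ≥0∞) ^ p⁻¹)
    (ENNReal.rpow_pos (by exact_mod_cast hκ) (by simp))
  refine ⟨stepFunction A '' t, ht.image _, ?_, fun f hf => ?_⟩
  · rintro _ ⟨c, -, rfl⟩
    exact memLp_stepFunction hAm hνA c _
  have hfm := hF f hf
  choose c hc0 hc using fun i => hC ν (z i) (r / 2) (A i) (half_pos hr) (hAz i) (hAm i) (hνA i) f hfm
  rw [mul_div_cancel₀ r two_ne_zero] at hc
  have hmeas (e : E) : Measurable fun x => ‖f x - e‖ₑ ^ p :=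
    (hfm.sub measurable_const).enorm.pow_const p
  have hsum : ∑ i, ∫⁻ x in A i, ‖f x - c i‖ₑ ^ p ∂ν ≤ C * δ := by
    calc ∑ i, ∫⁻ x in A i, ‖f x - c i‖ₑ ^ p ∂ν
        ≤ ∑ i, C * ∫⁻ x in A i, meanOscillation μ q r f x ^ s ∂ν :=
          Finset.sum_le_sum fun i _ => hc i
      _ = C * ∫⁻ x in ⋃ i, A i, meanOscillation μ q r f x ^ s ∂ν := by
          rw [← Finset.mul_sum, lintegral_iUnion hAm hAd, tsum_fintype]
      _ ≤ C * δ := by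
          gcongr
          exact (setLIntegral_le_lintegral _ _).trans (hr' f hf)
  have hmem : c ∈ {c : Fin N → E | ∀ i, ‖c i‖ₑ ^ p * ν (A i) ≤ 2 ^ p * (C * δ + M) ∧
      (ν (A i) = 0 → c i = 0)} := by
    refine fun i => ⟨?_, hc0 i⟩
    rw [← setLIntegral_const]
    calc ∫⁻ _ in A i, ‖c i‖ₑ ^ p ∂ν
        ≤ ∫⁻ x in A i, 2 ^ p * (‖f x - c i‖ₑ ^ p + ‖f x‖ₑ ^ p) ∂ν := by
          refine lintegral_mono fun x => ?_
          refine le_trans ?_ (ENNReal.add_rpow_le_two_rpow_mul _ _ hp.le)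
          gcongr
          rw [← enorm_neg (f x - c i), neg_sub]
          simpa using enorm_add_le (c i - f x) (f x)
      _ = 2 ^ p * (∫⁻ x in A i, ‖f x - c i‖ₑ ^ p ∂ν + ∫⁻ x in A i, ‖f x‖ₑ ^ p ∂ν) := by
          rw [lintegral_const_mul' _ _ (by finiteness),
            lintegral_add_left (hmeas (c i))]
      _ ≤ 2 ^ p * (C * δ + M) := by
          gcongr
          · exact (Finset.single_le_sum (f := fun i => ∫⁻ x in A i, ‖f x - c i‖ₑ ^ p ∂ν)
              (fun _ _ => zero_le) (Finset.mem_univ i)).trans hsum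
          · exact (setLIntegral_le_lintegral _ _).trans (hbdd f hf)
  obtain ⟨c', hc't, hc'⟩ := mem_iUnion₂.1 (hcov hmem)
  refine ⟨_, mem_image_of_mem _ hc't, lt_of_le_of_lt ?_ hδε⟩
  have hdist (i) : ‖c i - c' i‖ₑ ^ p ≤ κ := by
    rw [← ENNReal.le_rpow_inv_iff hp, ← edist_eq_enorm_sub]
    exact (edist_le_pi_edist c c' i).trans (le_of_lt hc')
  rw [lintegral_sub_stepFunction hAm hAd]
  calc (∑ i, ∫⁻ x in A i, ‖f x - c' i‖ₑ ^ p ∂ν) + ∫⁻ x in (⋃ i, A i)ᶜ, ‖f x‖ₑ ^ p ∂ν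
      ≤ (∑ i, 2 ^ p * (∫⁻ x in A i, ‖f x - c i‖ₑ ^ p ∂ν + κ * ν (A i))) + δ := by
        gcongr with i
        · calc ∫⁻ x in A i, ‖f x - c' i‖ₑ ^ p ∂ν
              ≤ ∫⁻ x in A i, 2 ^ p * (‖f x - c i‖ₑ ^ p + κ) ∂ν := by
                refine lintegral_mono fun x => ?_
                refine le_trans ?_ ((ENNReal.add_rpow_le_two_rpow_mul _ _ hp.le).trans
                  (mul_le_mul_right (add_le_add_right (hdist i) _) _))
                gcongr
                rw [← sub_add_sub_cancel (f x) (c i) (c' i)]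
                exact enorm_add_le _ _
            _ = _ := by
                rw [lintegral_const_mul' _ _ (by finiteness),
                  lintegral_add_left (hmeas (c i)),
                  setLIntegral_const]
        · exact (lintegral_mono_set (compl_subset_compl.2 hAR)).trans (hR f hf)
    _ = 2 ^ p * (∑ i, ∫⁻ x in A i, ‖f x - c i‖ₑ ^ p ∂ν + κ * ∑ i, ν (A i)) + δ := by
        rw [← Finset.mul_sum, Finset.sum_add_distrib, Finset.mul_sum]
    _ ≤ 2 ^ p * (C * δ + δ) + δ := by gcongr
    _ = _ := by ring

end FiniteNet

/-! ### Muckenhoupt weights and averaging operators -/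

section Muckenhoupt

variable {X : Type*} [MetricSpace X] [MeasurableSpace X] {μ : Measure X} {w : X → ℝ≥0∞} {p : ℝ}

omit [MetricSpace X] in
theorem IsWeight.lintegral_withDensity (hw : IsWeight μ w) {g : X → ℝ≥0∞} (hg : Measurable g) :
    ∫⁻ x, g x ∂μ.withDensity w = ∫⁻ x, g x * w x ∂μ := by
  rw [lintegral_withDensity_eq_lintegral_mul₀ hw.aemeasurable hg.aemeasurable]
  simp [mul_comm]

omit [MetricSpace X] in
theorem laverage_mul_eq_setLIntegral {s : Set X} (h0 : μ s ≠ 0) (ht : μ s ≠ ∞) (g : X → ℝ≥0∞) :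
    (⨍⁻ x in s, g x ∂μ) * μ s = ∫⁻ x in s, g x ∂μ := by
  rw [setLAverage_eq, ENNReal.div_mul_cancel h0 ht]

theorem laverage_mul_laverage_le_muckenhouptConst (x : X) {r : ℝ} (hr : 0 < r) :
    (⨍⁻ y in Metric.ball x r, w y ∂μ) *
      (⨍⁻ y in Metric.ball x r, w y ^ (1 - p.conjExponent) ∂μ) ^ (p - 1) ≤
        muckenhouptConst p μ w :=
  le_iSup_of_le x (le_iSup_of_le r (le_iSup_of_le hr le_rfl))

omit [MetricSpace X] in
/-- Hölder's inequality against a weight and its dual weight. -/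
theorem IsWeight.lintegral_rpow_le (hw : IsWeight μ w) (hp : 1 < p) {m : Measure X} (hm : m ≪ μ)
    {g : X → ℝ≥0∞} (hg : Measurable g) :
    (∫⁻ x, g x ∂m) ^ p ≤
      (∫⁻ x, g x ^ p * w x ∂m) * (∫⁻ x, w x ^ (1 - p.conjExponent) ∂m) ^ (p - 1) := by
  have hpq := Real.HolderConjugate.conjExponent hp
  have hp0 : 0 < p := by linarith
  have hwm : AEMeasurable w m := hw.aemeasurable.mono_ac hm
  -- Factor `g = (g w^(1/p)) · w^(-1/p)`, legitimate where `0 < w < ∞`.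
  have h1 : ∫⁻ x, g x ∂m = ∫⁻ x, ((fun x => g x * w x ^ p⁻¹) * fun x => w x ^ (-p⁻¹)) x ∂m := by
    refine lintegral_congr_ae ?_
    filter_upwards [hm.ae_le hw.pos, hm.ae_le hw.lt_top] with x h0 ht
    rw [Pi.mul_apply, mul_assoc, ← ENNReal.rpow_add _ _ h0.ne' ht.ne]
    simp
  have hexp : -p⁻¹ * p.conjExponent = 1 - p.conjExponent := by
    have := hpq.sub_one_mul_conj
    field_simp
    linarith
  have h2 : 1 / p.conjExponent * p = p - 1 := by
    have := hpq.sub_one_mul_conj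
    have := hpq.symm.pos
    field_simp
    linarith
  rw [h1]
  refine (ENNReal.rpow_le_rpow (ENNReal.lintegral_mul_le_Lp_mul_Lq m hpq
    (hg.aemeasurable.mul (hwm.pow_const _)) (hwm.pow_const _)) hp0.le).trans (le_of_eq ?_)
  rw [ENNReal.mul_rpow_of_nonneg _ _ hp0.le, ← ENNReal.rpow_mul, ← ENNReal.rpow_mul, h2,
    one_div, inv_mul_cancel₀ hp0.ne', ENNReal.rpow_one]
  congr 1
  · refine lintegral_congr fun x => ?_
    rw [Pi.mul_apply, ENNReal.mul_rpow_of_nonneg _ _ hp0.le, ← ENNReal.rpow_mul, inv_mul_cancel₀ hp0.ne',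
      ENNReal.rpow_one]
  · congr 1
    refine lintegral_congr fun x => ?_
    rw [← ENNReal.rpow_mul, hexp]

/-- The `A_p` condition as a bound of averages:
`(⨍_B g dμ)^p w(B) ≤ [w]_{A_p} ∫_B g^p w dμ`. -/
theorem IsMuckenhoupt.laverage_rpow_mul_le [BorelSpace X] (hw : IsMuckenhoupt p μ w)
    (hμ : IsHomogeneousType μ) (hp : 1 < p) (x : X) {r : ℝ} (hr : 0 < r) {g : X → ℝ≥0∞}
    (hg : Measurable g) :
    (⨍⁻ y in Metric.ball x r, g y ∂μ) ^ p * μ.withDensity w (Metric.ball x r) ≤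
      muckenhouptConst p μ w * ∫⁻ y in Metric.ball x r, g y ^ p ∂μ.withDensity w := by
  have hb := (Metric.isOpen_ball (x := x) (ε := r)).measurableSet
  have h0 := (hμ.measure_ball_pos x r hr).ne'
  have ht := (hμ.measure_ball_lt_top x r hr).ne
  -- Hölder is applied to the normalized restriction of `μ` to the ball, whose integrals are the
  -- averages in the `A_p` condition.
  have hac : (μ.restrict (Metric.ball x r) univ)⁻¹ • μ.restrict (Metric.ball x r) ≪ μ :=
    (Measure.smul_absolutelyContinuous).trans Measure.restrict_le_self.absolutelyContinuous
  have hH := hw.isWeight.lintegral_rpow_le hp hac hg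
  change (⨍⁻ y in Metric.ball x r, g y ∂μ) ^ p ≤ (⨍⁻ y in Metric.ball x r, g y ^ p * w y ∂μ) *
    (⨍⁻ y in Metric.ball x r, w y ^ (1 - p.conjExponent) ∂μ) ^ (p - 1) at hH
  have hgw : ∫⁻ y in Metric.ball x r, g y ^ p ∂μ.withDensity w =
      ∫⁻ y in Metric.ball x r, g y ^ p * w y ∂μ := by
    rw [restrict_withDensity hb, lintegral_withDensity_eq_lintegral_mul₀
      hw.isWeight.aemeasurable.restrict (hg.pow_const p).aemeasurable]
    simp [mul_comm]
  rw [withDensity_apply _ hb, ← laverage_mul_eq_setLIntegral h0 ht, hgw,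
    ← laverage_mul_eq_setLIntegral h0 ht, ← mul_assoc, ← mul_assoc]
  gcongr ?_ * _
  refine (mul_le_mul_left hH _).trans ?_
  rw [mul_assoc, mul_comm]
  gcongr
  rw [mul_comm]
  exact laverage_mul_laverage_le_muckenhouptConst x hr

theorem IsMuckenhoupt.withDensity_ball_pos [BorelSpace X] (hw : IsMuckenhoupt p μ w)
    (hμ : IsHomogeneousType μ) (x : X) {r : ℝ} (hr : 0 < r) :
    0 < μ.withDensity w (Metric.ball x r) := by
  refine pos_iff_ne_zero.2 fun h => (hμ.measure_ball_pos x r hr).ne' ?_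
  have hac : μ ≪ μ.withDensity w :=
    withDensity_absolutelyContinuous' hw.isWeight.aemeasurable
      (hw.isWeight.pos.mono fun _ h => h.ne')
  exact hac h

/-- The average of the dual weight is nonzero, so an infinite average of `w` would make the
Muckenhoupt product infinite. -/
theorem IsMuckenhoupt.withDensity_ball_lt_top [BorelSpace X] (hw : IsMuckenhoupt p μ w)
    (hμ : IsHomogeneousType μ) (hp : 1 < p) (x : X) {r : ℝ} (hr : 0 < r) :
    μ.withDensity w (Metric.ball x r) < ∞ := by
  have hb := (Metric.isOpen_ball (x := x) (ε := r)).measurableSet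
  have h0 := (hμ.measure_ball_pos x r hr).ne'
  have ht := (hμ.measure_ball_lt_top x r hr).ne
  have hσ : ⨍⁻ y in Metric.ball x r, w y ^ (1 - p.conjExponent) ∂μ ≠ 0 := by
    rw [setLAverage_eq]
    refine ENNReal.div_ne_zero.2 ⟨fun h => ?_, ht⟩
    rw [lintegral_eq_zero_iff' (hw.isWeight.aemeasurable.restrict.pow_const _)] at h
    have hne : NeBot (ae (μ.restrict (Metric.ball x r))) := by
      rw [ae_neBot]; exact fun h' => h0 (Measure.restrict_eq_zero.1 h')
    obtain ⟨y, hy, hy0, hyt⟩ := (h.and ((ae_restrict_of_ae hw.isWeight.pos).and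
      (ae_restrict_of_ae hw.isWeight.lt_top))).exists
    exact (ENNReal.rpow_pos hy0 hyt.ne).ne' hy
  have hbd := (laverage_mul_laverage_le_muckenhouptConst x hr).trans_lt hw.const_lt_top
  have hav : ⨍⁻ y in Metric.ball x r, w y ∂μ ≠ ∞ := by
    intro h
    rw [h, ENNReal.top_mul] at hbd
    · exact lt_irrefl _ hbd
    · exact (ENNReal.rpow_pos_of_nonneg (pos_iff_ne_zero.2 hσ) (by linarith)).ne'
  rw [withDensity_apply _ hb, ← laverage_mul_eq_setLIntegral h0 ht]
  exact ENNReal.mul_lt_top hav.lt_top ht.lt_top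

/-- An `A_p` weight is doubling. -/
theorem IsMuckenhoupt.withDensity_isHomogeneousType [BorelSpace X] (hw : IsMuckenhoupt p μ w)
    (hμ : IsHomogeneousType μ) (hp : 1 < p) : IsHomogeneousType (μ.withDensity w) where
  measure_ball_pos x r hr := hw.withDensity_ball_pos hμ x hr
  measure_ball_lt_top x r hr := hw.withDensity_ball_lt_top hμ hp x hr
  doubling := by
    obtain ⟨C, hC⟩ := hμ.doubling
    have hp0 : 0 ≤ p := by linarith
    refine ⟨C ^ p * (muckenhouptConst p μ w).toNNReal, fun x r hr => ?_⟩
    have hr2 : 0 < 2 * r := by positivity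
    have hsub : Metric.ball x r ⊆ Metric.ball x (2 * r) := Metric.ball_subset_ball (by linarith)
    have hb := (Metric.isOpen_ball (x := x) (ε := r)).measurableSet
    -- Test the `A_p` bound on `B(x, 2r)` with the indicator of `B(x, r)`.
    have h := hw.laverage_rpow_mul_le hμ hp x hr2
      (g := (Metric.ball x r).indicator fun _ => 1) (measurable_const.indicator hb)
    have hpow (y : X) : (Metric.ball x r).indicator (fun _ => (1 : ℝ≥0∞)) y ^ p =
        (Metric.ball x r).indicator (fun _ => 1) y := by
      by_cases hy : y ∈ Metric.ball x r
      · simp [hy]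
      · simp [hy, show 0 < p by linarith]
    have hint (m : Measure X) : ∫⁻ y in Metric.ball x (2 * r),
        (Metric.ball x r).indicator (fun _ => 1) y ∂m = m (Metric.ball x r) := by
      rw [lintegral_indicator_const hb, one_mul, Measure.restrict_apply hb,
        inter_eq_left.2 hsub]
    simp_rw [hpow, hint, setLAverage_eq, hint] at h
    have hav : 1 ≤ C * (μ (Metric.ball x r) / μ (Metric.ball x (2 * r))) := by
      rw [← mul_div_assoc]
      refine (ENNReal.le_div_iff_mul_le (Or.inl (hμ.measure_ball_pos x _ hr2).ne')
        (Or.inl (hμ.measure_ball_lt_top x _ hr2).ne)).2 ?_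
      rw [one_mul]; exact hC x r hr
    calc μ.withDensity w (Metric.ball x (2 * r))
        = 1 ^ p * μ.withDensity w (Metric.ball x (2 * r)) := by simp
      _ ≤ (C * (μ (Metric.ball x r) / μ (Metric.ball x (2 * r)))) ^ p *
          μ.withDensity w (Metric.ball x (2 * r)) := by gcongr
      _ = C ^ p * ((μ (Metric.ball x r) / μ (Metric.ball x (2 * r))) ^ p *
          μ.withDensity w (Metric.ball x (2 * r))) := by
          rw [ENNReal.mul_rpow_of_nonneg _ _ hp0, mul_assoc]
      _ ≤ C ^ p * (muckenhouptConst p μ w * μ.withDensity w (Metric.ball x r)) := by gcongr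
      _ = _ := by
          push_cast
          rw [ENNReal.coe_toNNReal hw.const_lt_top.ne, ENNReal.coe_rpow_of_nonneg _ hp0, mul_assoc]

/-- For `x ∈ B(y, r)` doubling gives `ν(B(y, r)) ≤ D ν(B(x, r))`. The integral is the kernel mass
left by Tonelli in the bound for averaging operators. -/
theorem IsHomogeneousType.lintegral_inv_measure_ball_le [BorelSpace X] {ν : Measure X}
    (hν : IsHomogeneousType ν) :
    ∃ D : ℝ≥0, ∀ (y : X) (r : ℝ), 0 < r →
      ∫⁻ x in Metric.ball y r, (ν (Metric.ball x r))⁻¹ ∂ν ≤ D := by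
  obtain ⟨D, hD⟩ := hν.doubling
  refine ⟨D, fun y r hr => ?_⟩
  have h0 := (hν.measure_ball_pos y r hr).ne'
  have ht := (hν.measure_ball_lt_top y r hr).ne
  have hle : ∀ x ∈ Metric.ball y r, (ν (Metric.ball x r))⁻¹ ≤ D * (ν (Metric.ball y r))⁻¹ := by
    intro x hx
    have hxr := (hν.measure_ball_pos x r hr).ne'
    have hxt := (hν.measure_ball_lt_top x r hr).ne
    have : ν (Metric.ball y r) ≤ D * ν (Metric.ball x r) :=
      (measure_mono (Metric.ball_subset_ball' (by
        have := Metric.mem_ball'.1 hx; linarith))).trans (hD x r hr)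
    rw [← div_eq_mul_inv, ENNReal.le_div_iff_mul_le (Or.inl h0) (Or.inl ht), mul_comm,
      ← div_eq_mul_inv]
    exact ENNReal.div_le_of_le_mul this
  calc ∫⁻ x in Metric.ball y r, (ν (Metric.ball x r))⁻¹ ∂ν
      ≤ ∫⁻ _ in Metric.ball y r, D * (ν (Metric.ball y r))⁻¹ ∂ν :=
        setLIntegral_mono' Metric.isOpen_ball.measurableSet hle
    _ = D := by rw [setLIntegral_const, mul_assoc, ENNReal.inv_mul_cancel h0 ht, mul_one]

/-- The averaging operators are bounded on `L^p(w)`, uniformly in the radius. -/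
theorem IsMuckenhoupt.lintegral_laverage_rpow_le [BorelSpace X] [SecondCountableTopology X]
    (hw : IsMuckenhoupt p μ w) (hμ : IsHomogeneousType μ) (hp : 1 < p)
    [SFinite (μ.withDensity w)] :
    ∃ C : ℝ≥0, ∀ r : ℝ, 0 < r → ∀ g : X → ℝ≥0∞, Measurable g →
      ∫⁻ x, (⨍⁻ y in Metric.ball x r, g y ∂μ) ^ p ∂μ.withDensity w ≤
        C * ∫⁻ x, g x ^ p ∂μ.withDensity w := by
  have hν := hw.withDensity_isHomogeneousType hμ hp
  obtain ⟨D, hD⟩ := hν.lintegral_inv_measure_ball_le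
  set ν := μ.withDensity w
  refine ⟨(muckenhouptConst p μ w).toNNReal * D, fun r hr g hg => ?_⟩
  have hM := hw.const_lt_top.ne
  have hgp : Measurable fun x => g x ^ p := hg.pow_const p
  have hS : MeasurableSet {z : X × X | dist z.2 z.1 < r} :=
    (isOpen_lt (by fun_prop) continuous_const).measurableSet
  have hinv : Measurable fun x => (ν (Metric.ball x r))⁻¹ := (measurable_measure_ball r).inv
  have hkey : Measurable (Function.uncurry fun x y => (Metric.ball x r).indicator
      (fun y => (ν (Metric.ball x r))⁻¹ * g y ^ p) y) :=
    ((hinv.comp measurable_fst).mul (hgp.comp measurable_snd)).indicator hS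
  -- Divide the `A_p` bound by `ν(B(x, r))`, integrate in `x`, and exchange integrals using the
  -- symmetry of `dist x y < r`.
  calc ∫⁻ x, (⨍⁻ y in Metric.ball x r, g y ∂μ) ^ p ∂ν
      ≤ ∫⁻ x, muckenhouptConst p μ w *
          ∫⁻ y in Metric.ball x r, (ν (Metric.ball x r))⁻¹ * g y ^ p ∂ν ∂ν := by
        refine lintegral_mono fun x => ?_
        have h0 := (hν.measure_ball_pos x r hr).ne'
        have ht := (hν.measure_ball_lt_top x r hr).ne
        rw [lintegral_const_mul _ hgp, mul_left_comm, mul_comm _⁻¹, ← div_eq_mul_inv]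
        exact (ENNReal.le_div_iff_mul_le (Or.inl h0) (Or.inl ht)).2
          (hw.laverage_rpow_mul_le hμ hp x hr hg)
    _ = muckenhouptConst p μ w * ∫⁻ x, ∫⁻ y, (Metric.ball x r).indicator
          (fun y => (ν (Metric.ball x r))⁻¹ * g y ^ p) y ∂ν ∂ν := by
        rw [lintegral_const_mul' _ _ hM]
        simp_rw [lintegral_indicator Metric.isOpen_ball.measurableSet]
    _ = muckenhouptConst p μ w * ∫⁻ y, ∫⁻ x, (Metric.ball x r).indicator
          (fun y => (ν (Metric.ball x r))⁻¹ * g y ^ p) y ∂ν ∂ν := by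
        rw [lintegral_lintegral_swap hkey.aemeasurable]
    _ = muckenhouptConst p μ w * ∫⁻ y, (∫⁻ x in Metric.ball y r, (ν (Metric.ball x r))⁻¹ ∂ν) *
          g y ^ p ∂ν := by
        congr 1
        refine lintegral_congr fun y => ?_
        rw [← lintegral_mul_const _ hinv, ← lintegral_indicator Metric.isOpen_ball.measurableSet]
        refine lintegral_congr fun x => ?_
        simp only [indicator, Metric.mem_ball, dist_comm]
    _ ≤ muckenhouptConst p μ w * ∫⁻ y, D * g y ^ p ∂ν := by
        gcongr with y
        exact hD y r hr
    _ = _ := by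
        rw [lintegral_const_mul _ hgp, ← mul_assoc]
        push_cast
        rw [ENNReal.coe_toNNReal hM]

end Muckenhoupt

/-! ### Mean oscillation in weighted spaces at small scales -/

section OscillationEstimates

variable {X : Type*} [MetricSpace X] [MeasurableSpace X] {E : Type*} [NormedAddCommGroup E]
  [MeasurableSpace E] [BorelSpace E] [SecondCountableTopology E] {μ : Measure X}

omit [MetricSpace X] in
theorem laverage_const_mul_add (s : Set X) {c : ℝ≥0∞} (hc : c ≠ ∞) {g h : X → ℝ≥0∞}
    (hg : Measurable g) : ⨍⁻ y in s, c * (g y + h y) ∂μ =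
      c * (⨍⁻ y in s, g y ∂μ + ⨍⁻ y in s, h y ∂μ) := by
  simp only [laverage]
  rw [lintegral_const_mul' _ _ hc, lintegral_add_left hg]

theorem meanOscillation_le_sub_add {q : ℝ} (hq : 0 ≤ q) (r : ℝ) {f g : X → E}
    (hg : Measurable g) (hf : Measurable f) (x : X) :
    meanOscillation μ q r f x ≤
      2 ^ q * (meanOscillation μ q r (fun x => f x - g x) x + meanOscillation μ q r g x) := by
  have hm : Measurable fun y => ‖f x - g x - (f y - g y)‖ₑ ^ q :=
    (measurable_const.sub (hf.sub hg)).enorm.pow_const q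
  unfold meanOscillation
  rw [← laverage_const_mul_add _ (by finiteness) hm]
  refine lintegral_mono fun y => ?_
  refine le_trans ?_ (ENNReal.add_rpow_le_two_rpow_mul _ _ hq)
  gcongr
  rw [show f x - f y = f x - g x - (f y - g y) + (g x - g y) by abel]
  exact enorm_add_le _ _

theorem lintegral_meanOscillation_rpow_le_sub_add [OpensMeasurableSpace X]
    [SecondCountableTopology X] [SFinite μ] {q s : ℝ} (hq : 0 ≤ q) (hs : 0 ≤ s) (ν : Measure X)
    (r : ℝ) {f g : X → E} (hf : Measurable f) (hg : Measurable g) :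
    ∫⁻ x, meanOscillation μ q r f x ^ s ∂ν ≤ (2 ^ q) ^ s * 2 ^ s *
      (∫⁻ x, meanOscillation μ q r (fun x => f x - g x) x ^ s ∂ν +
        ∫⁻ x, meanOscillation μ q r g x ^ s ∂ν) := by
  have hm : Measurable fun x => meanOscillation μ q r (fun x => f x - g x) x ^ s :=
    (measurable_meanOscillation q r (hf.sub hg)).pow_const s
  rw [← lintegral_add_left hm,
    ← lintegral_const_mul' _ _ (by finiteness)]
  refine lintegral_mono fun x => ?_
  refine (ENNReal.rpow_le_rpow (meanOscillation_le_sub_add hq r hg hf x) hs).trans ?_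
  rw [ENNReal.mul_rpow_of_nonneg _ _ hs, mul_assoc]
  gcongr
  exact ENNReal.add_rpow_le_two_rpow_mul _ _ hs

omit [SecondCountableTopology E] in
-- Pointwise, the oscillation is at most `2 ^ q` times `|f|^q` plus its average, and averaging is
-- bounded on `L^s(w)`. The constant does not depend on `r`.
theorem IsMuckenhoupt.lintegral_meanOscillation_rpow_le [BorelSpace X] [SecondCountableTopology X]
    {w : X → ℝ≥0∞} {s : ℝ} (hw : IsMuckenhoupt s μ w) (hμ : IsHomogeneousType μ) (hs : 1 < s)
    [SFinite (μ.withDensity w)] {q : ℝ} (hq : 0 < q) :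
    ∃ C : ℝ≥0, ∀ r : ℝ, 0 < r → ∀ f : X → E, Measurable f →
      ∫⁻ x, meanOscillation μ q r f x ^ s ∂μ.withDensity w ≤
        C * ∫⁻ x, ‖f x‖ₑ ^ (q * s) ∂μ.withDensity w := by
  obtain ⟨C, hC⟩ := hw.lintegral_laverage_rpow_le hμ hs
  have hs0 : 0 ≤ s := by linarith
  have hK : (2 ^ q) ^ s * 2 ^ s * (1 + (C : ℝ≥0∞)) ≠ ∞ := by finiteness
  refine ⟨((2 ^ q) ^ s * 2 ^ s * (1 + (C : ℝ≥0∞))).toNNReal, fun r hr f hf => ?_⟩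
  rw [ENNReal.coe_toNNReal hK]
  have hfq : Measurable fun x => ‖f x‖ₑ ^ q := hf.enorm.pow_const q
  have hpt (x : X) : meanOscillation μ q r f x ≤
      2 ^ q * (‖f x‖ₑ ^ q + ⨍⁻ y in Metric.ball x r, ‖f y‖ₑ ^ q ∂μ) := by
    rw [← setLAverage_const (hμ.measure_ball_pos x r hr).ne' (hμ.measure_ball_lt_top x r hr).ne
      (‖f x‖ₑ ^ q), ← laverage_const_mul_add _ (by finiteness) measurable_const]
    refine lintegral_mono fun y => ?_
    refine le_trans ?_ (ENNReal.add_rpow_le_two_rpow_mul _ _ hq.le)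
    gcongr
    exact enorm_sub_le
  calc ∫⁻ x, meanOscillation μ q r f x ^ s ∂μ.withDensity w
      ≤ ∫⁻ x, (2 ^ q) ^ s * 2 ^ s * (‖f x‖ₑ ^ (q * s) +
          (⨍⁻ y in Metric.ball x r, ‖f y‖ₑ ^ q ∂μ) ^ s) ∂μ.withDensity w := by
        refine lintegral_mono fun x => (ENNReal.rpow_le_rpow (hpt x) hs0).trans ?_
        rw [ENNReal.mul_rpow_of_nonneg _ _ hs0, mul_assoc, ENNReal.rpow_mul]
        gcongr
        exact ENNReal.add_rpow_le_two_rpow_mul _ _ hs0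
    _ = (2 ^ q) ^ s * 2 ^ s * (∫⁻ x, ‖f x‖ₑ ^ (q * s) ∂μ.withDensity w +
          ∫⁻ x, (⨍⁻ y in Metric.ball x r, ‖f y‖ₑ ^ q ∂μ) ^ s ∂μ.withDensity w) := by
        rw [lintegral_const_mul' _ _ (by finiteness),
          lintegral_add_left (hf.enorm.pow_const (q * s))]
    _ ≤ (2 ^ q) ^ s * 2 ^ s * (∫⁻ x, ‖f x‖ₑ ^ (q * s) ∂μ.withDensity w +
          C * ∫⁻ x, ‖f x‖ₑ ^ (q * s) ∂μ.withDensity w) := by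
        gcongr
        simpa only [ENNReal.rpow_mul] using hC r hr _ hfq
    _ = _ := by ring

omit [MeasurableSpace E] [BorelSpace E] [SecondCountableTopology E] in
-- Uniform continuity makes the oscillation uniformly small, and for `r ≤ 1` it vanishes outside the
-- ball `B(x₀, R + 1)`, which has finite measure.
theorem IsHomogeneousType.exists_lintegral_meanOscillation_le_of_hasCompactSupport
    [OpensMeasurableSpace X] (hμ : IsHomogeneousType μ) {q s : ℝ} (hq : 0 < q) (hs : 0 < s)
    {ν : Measure X} (hν : ∀ (x : X) (r : ℝ), ν (Metric.ball x r) ≠ ∞) {h : X → E}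
    (hc : Continuous h) (hsupp : HasCompactSupport h) {ε : ℝ≥0∞} (hε : 0 < ε) :
    ∃ r₀ : ℝ, 0 < r₀ ∧ ∀ r : ℝ, 0 < r → r ≤ r₀ →
      ∫⁻ x, meanOscillation μ q r h x ^ s ∂ν ≤ ε := by
  rcases isEmpty_or_nonempty X with hX | ⟨⟨x₀⟩⟩
  · exact ⟨1, one_pos, fun r _ _ => by simp [lintegral_of_isEmpty]⟩
  have hqs : 0 < q * s := mul_pos hq hs
  obtain ⟨R, hR⟩ := hsupp.isCompact.isBounded.subset_ball x₀
  obtain ⟨κ, hκ, hκε⟩ := ENNReal.exists_nnreal_pos_mul_lt (hν x₀ (R + 1)) hε.ne'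
  obtain ⟨d, hd, hdist⟩ := EMetric.uniformContinuous_iff.1
    (hsupp.uniformContinuous_of_continuous hc) ((κ : ℝ≥0∞) ^ (q * s)⁻¹)
    (ENNReal.rpow_pos (by exact_mod_cast hκ) (by simp))
  obtain ⟨d', hd', hdd'⟩ := ENNReal.lt_iff_exists_nnreal_btwn.1 hd
  refine ⟨min 1 (d' : ℝ), by
    have : 0 < d' := by exact_mod_cast hd'
    positivity, fun r hr hr' => ?_⟩
  have hr1 : r ≤ 1 := hr'.trans (min_le_left _ _)
  have hpt (x y : X) (hy : y ∈ Metric.ball x r) : ‖h x - h y‖ₑ ^ q ≤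
      (Metric.ball x₀ (R + 1)).indicator (fun _ => (κ : ℝ≥0∞) ^ s⁻¹) x := by
    by_cases hx : x ∈ Metric.ball x₀ (R + 1)
    · rw [indicator_of_mem hx, show (κ : ℝ≥0∞) ^ s⁻¹ = ((κ : ℝ≥0∞) ^ (q * s)⁻¹) ^ q by
        rw [← ENNReal.rpow_mul]; congr 1; field_simp, ← edist_eq_enorm_sub]
      refine ENNReal.rpow_le_rpow (hdist ?_).le hq.le
      refine lt_trans ?_ hdd'
      rw [edist_dist, ← ENNReal.ofReal_coe_nnreal]
      have h1 : dist x y < d' := (Metric.mem_ball'.1 hy).trans_le (hr'.trans (min_le_right _ _))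
      exact (ENNReal.ofReal_lt_ofReal_iff (dist_nonneg.trans_lt h1)).2 h1
    · rw [Metric.mem_ball, not_lt] at hx
      have hzero (u : X) (hu : R ≤ dist u x₀) : h u = 0 := by
        refine image_eq_zero_of_notMem_tsupport fun hmem => ?_
        exact (Metric.mem_ball.1 (hR hmem)).not_ge hu
      have hy' := Metric.mem_ball'.1 hy
      rw [hzero x (by linarith), hzero y (by linarith [dist_triangle x y x₀]), sub_zero,
        enorm_zero, ENNReal.zero_rpow_of_pos hq]
      exact zero_le
  calc ∫⁻ x, meanOscillation μ q r h x ^ s ∂ν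
      ≤ ∫⁻ x, (Metric.ball x₀ (R + 1)).indicator (fun _ => (κ : ℝ≥0∞)) x ∂ν := by
        refine lintegral_mono fun x => ?_
        have hle : meanOscillation μ q r h x ≤
            (Metric.ball x₀ (R + 1)).indicator (fun _ => (κ : ℝ≥0∞) ^ s⁻¹) x := by
          refine le_trans ?_ (setLAverage_const (hμ.measure_ball_pos x r hr).ne'
            (hμ.measure_ball_lt_top x r hr).ne _).le
          unfold meanOscillation
          rw [setLAverage_eq, setLAverage_eq]
          gcongr ?_ / _
          exact setLIntegral_mono' Metric.isOpen_ball.measurableSet (hpt x)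
        refine (ENNReal.rpow_le_rpow hle hs.le).trans (le_of_eq ?_)
        by_cases hx : x ∈ Metric.ball x₀ (R + 1)
        · rw [indicator_of_mem hx, indicator_of_mem hx, ENNReal.rpow_inv_rpow hs.ne']
        · rw [indicator_of_notMem hx, indicator_of_notMem hx, ENNReal.zero_rpow_of_pos hs]
    _ = κ * ν (Metric.ball x₀ (R + 1)) :=
        lintegral_indicator_const Metric.isOpen_ball.measurableSet _
    _ ≤ ε := hκε.le

/-- The mean oscillations of an `L^p(w)` function tend to `0` with the scale. -/
theorem IsMuckenhoupt.exists_lintegral_meanOscillation_le [BorelSpace X] [ProperSpace X]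
    [NormedSpace ℝ E] {w : X → ℝ≥0∞} {s : ℝ} (hw : IsMuckenhoupt s μ w) (hμ : IsHomogeneousType μ)
    (hs : 1 < s) {q : ℝ} (hq : 0 < q) {f : X → E} (hf : Measurable f)
    (hfp : MemLp f (ENNReal.ofReal (q * s)) (μ.withDensity w)) {ε : ℝ≥0∞} (hε : 0 < ε) :
    ∃ r₀ : ℝ, 0 < r₀ ∧ ∀ r : ℝ, 0 < r → r ≤ r₀ →
      ∫⁻ x, meanOscillation μ q r f x ^ s ∂μ.withDensity w ≤ ε := by
  have hν := hw.withDensity_isHomogeneousType hμ hs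
  have := hμ.isLocallyFiniteMeasure
  have := hν.isLocallyFiniteMeasure
  have hs0 : 0 < s := by linarith
  have hqs : 0 < q * s := mul_pos hq hs0
  obtain ⟨C, hC⟩ := hw.lintegral_meanOscillation_rpow_le (E := E) hμ hs hq
  obtain ⟨δ, hδ, hδε⟩ := ENNReal.exists_nnreal_pos_mul_lt
    (a := (2 ^ q) ^ s * 2 ^ s * ((C : ℝ≥0∞) + 1)) (by finiteness) hε.ne'
  have hδ' : (0 : ℝ≥0∞) < δ := by exact_mod_cast hδ
  -- Split `f = (f - g) + g`: the bound uniform in `r` handles `f - g`, small radii handle `g`.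
  obtain ⟨g, hgs, hfg, hgc, -⟩ := hfp.exists_hasCompactSupport_eLpNorm_sub_le
    ENNReal.ofReal_ne_top (ENNReal.rpow_pos (p := (q * s)⁻¹) hδ' (by simp)).ne'
  obtain ⟨r₀, hr₀, h⟩ := hμ.exists_lintegral_meanOscillation_le_of_hasCompactSupport hq hs0
    (ν := μ.withDensity w) (fun x r => (measure_mono (Metric.ball_subset_ball
      (le_max_left r 1))).trans_lt (hν.measure_ball_lt_top x _ (by positivity)) |>.ne) hgc hgs hδ'
  refine ⟨r₀, hr₀, fun r hr hr' => ?_⟩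
  refine (lintegral_meanOscillation_rpow_le_sub_add hq.le hs0.le _ r hf hgc.measurable).trans
    (le_trans ?_ hδε.le)
  rw [mul_comm (δ : ℝ≥0∞), mul_assoc _ _ (δ : ℝ≥0∞), add_mul, one_mul]
  gcongr
  · refine (hC r hr _ (hf.sub hgc.measurable)).trans ?_
    gcongr
    rw [ENNReal.le_rpow_inv_iff hqs, eLpNorm_ofReal_rpow hqs] at hfg
    exact hfg
  · exact h r hr hr'

end OscillationEstimates

/-! ### Perturbation and tails of single functions -/

section Net

variable {X : Type*} [MeasurableSpace X] {E : Type*} [NormedAddCommGroup E] {ν : Measure X}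

/-- Used with `S = univ` for boundedness and with complements of balls for tails. -/
theorem Lp.eLpNorm_restrict_le_sub_add {P : ℝ≥0∞} (f g : Lp E P ν) (S : Set X) :
    eLpNorm f P (ν.restrict S) ≤
      ENNReal.LpAddConst P * (eLpNorm (f - g : Lp E P ν) P ν + eLpNorm g P (ν.restrict S)) := by
  have h : (f : X → E) =ᵐ[ν] ⇑(f - g) + ⇑g := by
    conv_lhs => rw [← sub_add_cancel f g]
    exact Lp.coeFn_add _ _
  rw [eLpNorm_congr_ae (ae_restrict_of_ae h)]
  refine (eLpNorm_add_le' (Lp.aestronglyMeasurable _).restrict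
    (Lp.aestronglyMeasurable _).restrict P).trans ?_
  gcongr
  exact Measure.restrict_le_self

/-- Continuity from above of the finite measure `g dν` along complements decreasing to the empty
set. -/
theorem tendsto_setLIntegral_compl_ball {X : Type*} [MetricSpace X] [MeasurableSpace X]
    [OpensMeasurableSpace X] {ν : Measure X} (x₀ : X) {g : X → ℝ≥0∞} (hg : ∫⁻ x, g x ∂ν ≠ ∞) :
    Tendsto (fun R : ℝ => ∫⁻ x in (Metric.ball x₀ R)ᶜ, g x ∂ν) atTop (𝓝 0) := by
  have hm (R : ℝ) : MeasurableSet (Metric.ball x₀ R)ᶜ := Metric.isOpen_ball.measurableSet.compl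
  have hI : ⋂ R : ℝ, (Metric.ball x₀ R)ᶜ = ∅ := by
    rw [← compl_iUnion, compl_empty_iff, eq_univ_iff_forall]
    exact fun x => mem_iUnion.2 ⟨dist x x₀ + 1, by simp⟩
  have h := tendsto_measure_iInter_atTop (μ := ν.withDensity g)
    (s := fun R : ℝ => (Metric.ball x₀ R)ᶜ) (fun R => (hm R).nullMeasurableSet)
    (fun a b hab => compl_subset_compl.2 (Metric.ball_subset_ball hab))
    ⟨0, by
      rw [withDensity_apply _ (hm 0)]
      exact ne_top_of_le_ne_top hg (setLIntegral_le_lintegral _ _)⟩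
  rw [hI, measure_empty] at h
  refine h.congr fun R => ?_
  exact withDensity_apply _ (hm R)

end Net

/-! ### Equivalence of the three conditions with finite nets -/

section Criterion

variable {X : Type*} [MetricSpace X] [MeasurableSpace X] [BorelSpace X] {𝕜 : Type*} [RCLike 𝕜]
  {μ : Measure X} {p : ℝ} {w : X → ℝ≥0∞}

omit [MetricSpace X] [BorelSpace X] in
theorem iSup_weightedLpNorm_lt_top_of_finite_net {K : Set (WeightedLp 𝕜 p μ w)}
    (hK : ∀ ε : ℝ≥0∞, 0 < ε → ∃ t : Set (WeightedLp 𝕜 p μ w), t.Finite ∧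
      ∀ f ∈ K, ∃ g ∈ t, weightedLpNorm p μ w (f - g : WeightedLp 𝕜 p μ w) < ε) :
    (⨆ f ∈ K, weightedLpNorm p μ w f) < ∞ := by
  obtain ⟨t, ht, hnet⟩ := hK 1 one_pos
  lift t to Finset (WeightedLp 𝕜 p μ w) using ht
  have hfin : ENNReal.LpAddConst (ENNReal.ofReal p) *
      (1 + ∑ g ∈ t, weightedLpNorm p μ w g) < ∞ :=
    ENNReal.mul_lt_top (ENNReal.LpAddConst_lt_top _) (ENNReal.add_lt_top.2 ⟨ENNReal.one_lt_top,
      ENNReal.sum_lt_top.2 fun g _ => Lp.eLpNorm_lt_top g⟩)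
  refine lt_of_le_of_lt (iSup₂_le fun f hf => ?_) hfin
  obtain ⟨g, hg, hfg⟩ := hnet f hf
  have h := Lp.eLpNorm_restrict_le_sub_add f g univ
  rw [Measure.restrict_univ] at h
  refine h.trans ?_
  gcongr
  exact Finset.single_le_sum (f := fun g : WeightedLp 𝕜 p μ w => weightedLpNorm p μ w g)
    (fun _ _ => zero_le) hg

theorem weightedLpNorm_compl_ball_indicator (f : X → 𝕜) (x₀ : X) (R : ℝ) :
    weightedLpNorm p μ w ((Metric.ball x₀ R)ᶜ.indicator f) =
      eLpNorm f (ENNReal.ofReal p) ((μ.withDensity w).restrict (Metric.ball x₀ R)ᶜ) :=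
  eLpNorm_indicator_eq_eLpNorm_restrict Metric.isOpen_ball.measurableSet.compl

theorem tendsto_iSup_tail_of_finite_net (hp : 0 < p) (x₀ : X) {K : Set (WeightedLp 𝕜 p μ w)}
    (hK : ∀ ε : ℝ≥0∞, 0 < ε → ∃ t : Set (WeightedLp 𝕜 p μ w), t.Finite ∧
      ∀ f ∈ K, ∃ g ∈ t, weightedLpNorm p μ w (f - g : WeightedLp 𝕜 p μ w) < ε) :
    Tendsto (fun A : ℝ => ⨆ f ∈ K, weightedLpNorm p μ w ((Metric.ball x₀ A)ᶜ.indicator f))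
      atTop (𝓝 0) := by
  refine ENNReal.tendsto_nhds_zero.2 fun ε hε => ?_
  obtain ⟨δ, hδ, hδε⟩ := ENNReal.exists_nnreal_pos_mul_lt
    (a := ENNReal.LpAddConst (ENNReal.ofReal p) * 2)
    (ENNReal.mul_ne_top (ENNReal.LpAddConst_lt_top _).ne (by simp)) hε.ne'
  have hδ' : (0 : ℝ≥0∞) < δ := by exact_mod_cast hδ
  obtain ⟨t, ht, hnet⟩ := hK δ hδ'
  have htail (g : WeightedLp 𝕜 p μ w) : ∀ᶠ A : ℝ in atTop, eLpNorm g (ENNReal.ofReal p)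
      ((μ.withDensity w).restrict (Metric.ball x₀ A)ᶜ) ≤ δ := by
    have hfin : ∫⁻ x, ‖g x‖ₑ ^ p ∂μ.withDensity w ≠ ∞ := by
      rw [← eLpNorm_ofReal_rpow hp]
      exact ENNReal.rpow_ne_top_of_nonneg hp.le (Lp.eLpNorm_ne_top g)
    filter_upwards [ENNReal.tendsto_nhds_zero.1 (tendsto_setLIntegral_compl_ball x₀ hfin)
      (δ ^ p) (ENNReal.rpow_pos hδ' (by simp))] with A hA
    rwa [← eLpNorm_ofReal_rpow hp, ENNReal.rpow_le_rpow_iff hp] at hA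
  filter_upwards [(eventually_all_finite ht).2 fun g _ => htail g] with A hA
  refine iSup₂_le fun f hf => ?_
  obtain ⟨g, hg, hfg⟩ := hnet f hf
  rw [weightedLpNorm_compl_ball_indicator]
  refine (Lp.eLpNorm_restrict_le_sub_add f g _).trans (le_trans ?_ hδε.le)
  rw [mul_comm (δ : ℝ≥0∞), mul_assoc, two_mul]
  gcongr
  exact hA g hg

omit [MetricSpace X] [BorelSpace X] in
theorem eLpNorm_sub_rpow (hp : 0 < p) {ν : Measure X} (f g : Lp 𝕜 (ENNReal.ofReal p) ν) :
    eLpNorm (f - g : Lp 𝕜 (ENNReal.ofReal p) ν) (ENNReal.ofReal p) ν ^ p =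
      ∫⁻ x, ‖f x - g x‖ₑ ^ p ∂ν := by
  rw [eLpNorm_congr_ae (Lp.coeFn_sub f g), eLpNorm_ofReal_rpow hp]
  rfl

/-- The radius need only suit the finitely many net elements; the error `f - g` is controlled at
every radius by the same constant. -/
theorem tendsto_iSup_meanOscillation_of_finite_net [ProperSpace X] {q s : ℝ} (hq : 0 < q)
    (hs : 1 < s) (hμ : IsHomogeneousType μ) (hw : IsMuckenhoupt s μ w)
    {K : Set (WeightedLp 𝕜 (q * s) μ w)}
    (hK : ∀ ε : ℝ≥0∞, 0 < ε → ∃ t : Set (WeightedLp 𝕜 (q * s) μ w), t.Finite ∧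
      ∀ f ∈ K, ∃ g ∈ t, weightedLpNorm (q * s) μ w (f - g : WeightedLp 𝕜 (q * s) μ w) < ε) :
    Tendsto (fun r : ℝ => ⨆ f ∈ K, ∫⁻ x, meanOscillation μ q r f x ^ s ∂μ.withDensity w)
      (𝓝[>] 0) (𝓝 0) := by
  have hν := hw.withDensity_isHomogeneousType hμ hs
  have := hμ.isLocallyFiniteMeasure
  have := hν.isLocallyFiniteMeasure
  have hs0 : 0 < s := by linarith
  have hqs : 0 < q * s := mul_pos hq hs0
  refine ENNReal.tendsto_nhds_zero.2 fun ε hε => ?_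
  obtain ⟨C, hC⟩ := hw.lintegral_meanOscillation_rpow_le (E := 𝕜) hμ hs hq
  obtain ⟨δ, hδ, hδε⟩ := ENNReal.exists_nnreal_pos_mul_lt
    (a := (2 ^ q) ^ s * 2 ^ s * ((C : ℝ≥0∞) + 1)) (by finiteness) hε.ne'
  have hδ' : (0 : ℝ≥0∞) < δ := by exact_mod_cast hδ
  obtain ⟨t, ht, hnet⟩ := hK ((δ : ℝ≥0∞) ^ (q * s)⁻¹) (ENNReal.rpow_pos hδ' (by simp))
  have hmeas (f : WeightedLp 𝕜 (q * s) μ w) : Measurable f := (Lp.stronglyMeasurable f).measurable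
  have hosc (g : WeightedLp 𝕜 (q * s) μ w) : ∀ᶠ r : ℝ in 𝓝[>] 0,
      ∫⁻ x, meanOscillation μ q r g x ^ s ∂μ.withDensity w ≤ δ := by
    obtain ⟨r₀, hr₀, h⟩ :=
      hw.exists_lintegral_meanOscillation_le hμ hs hq (hmeas g) (Lp.memLp g) hδ'
    filter_upwards [Ioc_mem_nhdsGT hr₀] with r hr using h r hr.1 hr.2
  filter_upwards [(eventually_all_finite ht).2 fun g _ => hosc g, self_mem_nhdsWithin] with r hr hr0
  refine iSup₂_le fun f hf => ?_
  obtain ⟨g, hg, hfg⟩ := hnet f hf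
  refine (lintegral_meanOscillation_rpow_le_sub_add hq.le hs0.le _ r (hmeas f) (hmeas g)).trans
    (le_trans ?_ hδε.le)
  rw [mul_comm (δ : ℝ≥0∞), mul_assoc _ _ (δ : ℝ≥0∞), add_mul, one_mul]
  gcongr
  · refine (hC r hr0 _ ((hmeas f).sub (hmeas g))).trans ?_
    gcongr
    refine (eLpNorm_sub_rpow hqs f g).ge.trans ?_
    rw [← ENNReal.le_rpow_inv_iff hqs]
    exact hfg.le
  · exact hr g hg

theorem exists_finite_net_of_tendsto [ProperSpace X] {q s : ℝ} (hq : 0 < q)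
    (hs : 1 < s) (hμ : IsHomogeneousType μ) (hw : IsMuckenhoupt s μ w) (x₀ : X)
    {K : Set (WeightedLp 𝕜 (q * s) μ w)}
    (hbdd : (⨆ f ∈ K, weightedLpNorm (q * s) μ w f) < ∞)
    (htail : Tendsto (fun A : ℝ => ⨆ f ∈ K,
      weightedLpNorm (q * s) μ w ((Metric.ball x₀ A)ᶜ.indicator f)) atTop (𝓝 0))
    (hosc : Tendsto (fun r : ℝ => ⨆ f ∈ K,
      ∫⁻ x, meanOscillation μ q r f x ^ s ∂μ.withDensity w) (𝓝[>] 0) (𝓝 0))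
    {ε : ℝ≥0∞} (hε : 0 < ε) :
    ∃ t : Set (WeightedLp 𝕜 (q * s) μ w), t.Finite ∧
      ∀ f ∈ K, ∃ g ∈ t, weightedLpNorm (q * s) μ w (f - g : WeightedLp 𝕜 (q * s) μ w) < ε := by
  have hν := hw.withDensity_isHomogeneousType hμ hs
  have := hμ.isLocallyFiniteMeasure
  have hs0 : 0 < s := by linarith
  have hqs : 0 < q * s := mul_pos hq hs0
  obtain ⟨t, ht, htLp, hnet⟩ := hμ.exists_finite_net hq hs0 (ν := μ.withDensity w)
    (fun x r => (measure_mono (Metric.ball_subset_ball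
      (le_max_left r 1))).trans_lt (hν.measure_ball_lt_top x _ (by positivity)) |>.ne)
    (F := (fun f : WeightedLp 𝕜 (q * s) μ w => (f : X → 𝕜)) '' K)
    (by rintro _ ⟨f, -, rfl⟩; exact (Lp.stronglyMeasurable f).measurable) x₀
    (M := (⨆ f ∈ K, weightedLpNorm (q * s) μ w f) ^ (q * s))
    (ENNReal.rpow_ne_top_of_nonneg hqs.le hbdd.ne)
    (by
      rintro _ ⟨f, hf, rfl⟩
      rw [← eLpNorm_ofReal_rpow hqs]
      refine ENNReal.rpow_le_rpow ?_ hqs.le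
      exact le_iSup₂ (f := fun (f : WeightedLp 𝕜 (q * s) μ w) (_ : f ∈ K) =>
        weightedLpNorm (q * s) μ w f) f hf)
    (by
      intro δ hδ
      obtain ⟨A, hA⟩ := (ENNReal.tendsto_nhds_zero.1 htail (δ ^ (q * s)⁻¹)
        (ENNReal.rpow_pos_of_nonneg hδ (by positivity))).exists
      refine ⟨A, ?_⟩
      rintro _ ⟨f, hf, rfl⟩
      rw [← eLpNorm_ofReal_rpow hqs, ← ENNReal.le_rpow_inv_iff hqs,
        ← weightedLpNorm_compl_ball_indicator]
      exact (iSup₂_le_iff.1 hA) f hf)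
    (by
      intro δ hδ
      obtain ⟨r, hr, hr0⟩ := ((ENNReal.tendsto_nhds_zero.1 hosc δ hδ).and
        self_mem_nhdsWithin).exists
      refine ⟨r, hr0, ?_⟩
      rintro _ ⟨f, hf, rfl⟩
      exact (iSup₂_le_iff.1 hr) f hf)
    (ε := ε ^ (q * s)) (ENNReal.rpow_pos_of_nonneg hε hqs.le)
  have := ht.to_subtype
  refine ⟨range fun g : t => (htLp g.1 g.2).toLp g.1, finite_range _, fun f hf => ?_⟩
  obtain ⟨g, hg, hfg⟩ := hnet _ ⟨f, hf, rfl⟩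
  refine ⟨_, mem_range_self ⟨g, hg⟩, ?_⟩
  rw [← ENNReal.rpow_lt_rpow_iff hqs, eLpNorm_sub_rpow hqs]
  refine lt_of_le_of_lt (le_of_eq (lintegral_congr_ae ?_)) hfg
  filter_upwards [(htLp g hg).coeFn_toLp] with x hx
  rw [hx]

end Criterion

theorem theorem1p10 {X : Type*} [MetricSpace X] [CompleteSpace X] [MeasurableSpace X]
    [BorelSpace X] {𝕜 : Type*} [RCLike 𝕜] (μ : Measure X) (hμ : IsHomogeneousType μ)
    (hμc : IsMetricallyContinuous μ) (x₀ : X) (p p₀ : ℝ) (hp : 0 < p) (hp₀ : 1 < p₀)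
    (w : X → ℝ≥0∞) (hw : IsMuckenhoupt p₀ μ w) (K : Set (WeightedLp 𝕜 p μ w)) :
    IsRelativelyCompactLp K ↔
      (⨆ f ∈ K, weightedLpNorm p μ w f) < ∞ ∧
      Tendsto (fun A : ℝ => ⨆ f ∈ K, weightedLpNorm p μ w ((Metric.ball x₀ A)ᶜ.indicator f))
        atTop (𝓝 0) ∧
      Tendsto (fun r : ℝ => ⨆ f ∈ K,
          ∫⁻ x, (⨍⁻ y in Metric.ball x r, ‖f x - f y‖ₑ ^ (p / p₀) ∂μ) ^ p₀ * w x ∂μ)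
        (𝓝[>] 0) (𝓝 0) := by
  have hp₀' : 0 < p₀ := by linarith
  -- Writing `p = q * p₀` turns the inner exponent `p / p₀` into `q`.
  obtain ⟨q, rfl⟩ : ∃ q, p = q * p₀ := ⟨p / p₀, by field_simp⟩
  have hq : 0 < q := pos_of_mul_pos_left hp hp₀'.le
  have := hμ.properSpace
  have := hμ.isLocallyFiniteMeasure
  have hint (r : ℝ) (f : WeightedLp 𝕜 (q * p₀) μ w) :
      ∫⁻ x, (⨍⁻ y in Metric.ball x r, ‖f x - f y‖ₑ ^ (q * p₀ / p₀) ∂μ) ^ p₀ * w x ∂μ =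
        ∫⁻ x, meanOscillation μ q r f x ^ p₀ ∂μ.withDensity w := by
    rw [hw.isWeight.lintegral_withDensity ((measurable_meanOscillation q r
      (Lp.stronglyMeasurable f).measurable).pow_const p₀), mul_div_cancel_right₀ q hp₀'.ne']
    rfl
  simp_rw [hint]
  rw [isRelativelyCompactLp_iff_finite_net hp]
  refine ⟨fun h => ⟨iSup_weightedLpNorm_lt_top_of_finite_net h,
    tendsto_iSup_tail_of_finite_net hp x₀ h,
    tendsto_iSup_meanOscillation_of_finite_net hq hp₀ hμ hw h⟩, fun ⟨hb, ht, ho⟩ ε hε =>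
    exists_finite_net_of_tendsto hq hp₀ hμ hw x₀ hb ht ho hε⟩
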